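/- Let $\Lambda$ be a space with a $\sigma$-finite measure $\mu$. A configuration is a countable set of points of $\Lambda$ with finitely many points in every compact set; a random point field on $\Lambda$ is a probability measure $\mathbb P$ on the space of configurations, with the $\sigma$-algebra generated by the counts $\#(A)$ of points in measurable sets $A$. A non-negative locally integrable function $R_k$ on $\Lambda^k$ is a $k$-point correlation function of the field (with respect to $\mu$) if, for all pairwise disjoint measurable $A_1,\dots,A_n\subset\Lambda$ and all integers $k_1,\dots,k_n\ge 0$ with $\sum_i k_i=k$, $$\mathbb E\prod_{i=1}^n \#(A_i)(\#(A_i)-1)\cdots(\#(A_i)-k_i+1)=\int_{A_1^{k_1}\times\cdots\times A_n^{k_n}}R_k(x_1,\dots,x_k)\,d\mu(x_1)\cdots d\mu(x_k).$$ Quaternions $q=s+x\mathbf i+y\mathbf j+z\mathbf k$ have complex coefficients $s,x,y,z$ (real quaternions have real ones), and $q^*=s-x\mathbf i-y\mathbf j-z\mathbf k$. The Moore–Dyson determinant of an $m\times m$ quaternion matrix $X$ is $$\mathrm{Det}_M(X)=\sum_{\sigma\in S_m}\varepsilon(\sigma)\,(X_{n_1i_2}X_{i_2i_3}\cdots X_{i_sn_1})\cdots(X_{n_rk_2}X_{k_2k_3}\cdots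 X_{k_ln_r}),$$ where $\sigma=(n_1i_2\dots i_s)\cdots(n_rk_2\dots k_l)$ is written in cycles, each starting with its largest element, with $n_1>\dots>n_r$, and $\varepsilon(\sigma)$ is the sign of $\sigma$. A quaternion kernel $K:\Lambda\times\Lambda\to\mathbb Q_{\mathbb C}$ is self-dual if $K(y,x)=K(x,y)^*$ for all $x,y$. A Pfaffian point field with self-dual kernel $K$ is a random point field that has, for every $m\ge1$, an $m$-point correlation function $R_m$ with $R_m(x_1,\dots,x_m)=\mathrm{Det}_M\big(K(x_i,x_j)\big)_{1\le i,j\le m}$ for $\mu^{m}$-almost every $(x_1,\dots,x_m)$. **Theorem.** Let $K$ be a self-dual quaternion kernel with a real diagonal form: there are a finite or countably infinite family of square-integrable real-quaternion functions $u_k$ on $\Lambda$ with $\int_\Lambda u_k^*(x)u_l(x)\,d\mu(x)=\delta_{kl}$, and real numbers $\lambda_k$, such that $$K(x,y)=\sum_k\lambda_k\,u_k(x)\,u_k^*(y),$$ with absolute convergence, for $\mu\otimes\mu$-almost every $(x,y)$, and also at $(x,x)$ for $\mu$-almost every $x$. Assume that $\lambda_k\in[0,1]$ for all $k$ and that $\sum_k\lambda_k<\infty$.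 Then there is a Pfaffian point field on $\Lambda$ with kernel $K$ whose expected number of points $\mathbb E\,\#(\Lambda)$ is finite. -/

import Mathlib

open MeasureTheory
open scoped Quaternion ENNReal

/-! ### Quaternion matrices and the Moore–Dyson determinant

Complexified quaternions are `ℍ[ℂ]`.  Their `star` is the quaternion conjugation
`s + x i + y j + z k ↦ s - x i - y j - z k`, which does not conjugate the complex coefficients. -/

/-- The inclusion of the real quaternions into the complexified quaternions. -/
noncomputable def realQuaternionToComplexified (q : ℍ[ℝ]) : ℍ[ℂ] :=
  ⟨(q.re : ℂ), (q.imI : ℂ), (q.imJ : ℂ), (q.imK : ℂ)⟩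

/-- The elements of `Fin n` that are the largest element of their cycle under `σ`
(fixed points included), listed in decreasing order. -/
def cycleLeaders {n : ℕ} (σ : Equiv.Perm (Fin n)) : List (Fin n) :=
  (List.finRange n).reverse.filter fun i => ∀ j, σ.SameCycle i j → j ≤ i

/-- The product `X i (σ i) * X (σ i) (σ² i) * ⋯ * X (σ^(s-1) i) i` along the cycle
`(i, σ i, …, σ^(s-1) i)` of `σ` through `i`. -/
noncomputable def cycleProduct {A : Type*} [Ring A] {n : ℕ} (X : Matrix (Fin n) (Fin n) A)
    (σ : Equiv.Perm (Fin n)) (i : Fin n) : A :=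
  ((List.range (Function.minimalPeriod σ i)).map fun t => X ((σ ^ t) i) ((σ ^ (t + 1)) i)).prod

/-- The Moore–Dyson determinant: the signed sum over permutations of the products along the cycles,
each cycle starting from its largest element, and the cycles ordered by decreasing largest
elements. -/
noncomputable def mooreDysonDet {A : Type*} [Ring A] {n : ℕ} (X : Matrix (Fin n) (Fin n) A) : A :=
  ∑ σ : Equiv.Perm (Fin n),
    ((Equiv.Perm.sign σ : ℤˣ) : ℤ) • ((cycleLeaders σ).map (cycleProduct X σ)).prod

/-- A quaternion kernel is self-dual if `K(y, x) = K(x, y)^*`. -/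
def IsSelfDualKernel {Λ : Type*} (K : Λ → Λ → ℍ[ℂ]) : Prop :=
  ∀ x y, K y x = star (K x y)

/-! ### Random point fields -/

/-- The space of configurations of points in `Λ`: countable subsets with finitely many points in
every compact set. -/
structure Configuration (Λ : Type*) [TopologicalSpace Λ] where
  /-- the set of points of the configuration -/
  carrier : Set Λ
  countable : carrier.Countable
  locallyFinite : ∀ C : Set Λ, IsCompact C → (carrier ∩ C).Finite

namespace Configuration

variable {Λ : Type*} [TopologicalSpace Λ]

/-- The number `#(A)` of points of the configuration located in `A`. -/
noncomputable def count (A : Set Λ) (S : Configuration Λ) : ℕ∞ :=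
  (S.carrier ∩ A).encard

/-- The `σ`-algebra generated by the events `#(A) = n`, for `A` measurable. -/
instance [MeasurableSpace Λ] : MeasurableSpace (Configuration Λ) :=
  MeasurableSpace.generateFrom
    {E | ∃ A : Set Λ, MeasurableSet A ∧ ∃ n : ℕ∞, E = {S | S.count A = n}}

/-- The falling factorial `#(A) (#(A) - 1) ⋯ (#(A) - k + 1)`.  The subtraction is truncated, which
is harmless: if `#(A) < k`, then one of the factors is `0`. -/
noncomputable def fallingCount (A : Set Λ) (k : ℕ) (S : Configuration Λ) : ℝ≥0∞ :=
  ∏ j ∈ Finset.range k, (((S.count A : ℕ∞) : ℝ≥0∞) - (j : ℝ≥0∞))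

end Configuration

/-- `R` is a `k`-point correlation function, with respect to `μ`, of the random point field with
law `P`.  The region of integration is `A₁^{k₁} × ⋯ × Aₙ^{kₙ}`, a subset of `Λ^k`. -/
structure IsCorrelationFunction {Λ : Type*} [TopologicalSpace Λ] [MeasurableSpace Λ]
    (μ : Measure Λ) (P : Measure (Configuration Λ)) (k : ℕ) (R : (Fin k → Λ) → ℝ) : Prop where
  nonneg : ∀ x, 0 ≤ R x
  aemeasurable : AEMeasurable R (Measure.pi fun _ : Fin k => μ)
  locallyIntegrable : LocallyIntegrable R (Measure.pi fun _ : Fin k => μ)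
  factorialMoment : ∀ (n : ℕ) (A : Fin n → Set Λ) (κ : Fin n → ℕ) (hκ : ∑ i, κ i = k),
    (∀ i, MeasurableSet (A i)) → (Pairwise fun i j => Disjoint (A i) (A j)) →
    ∫⁻ S, ∏ i, S.fallingCount (A i) (κ i) ∂P =
      ∫⁻ x in {x : Fin k → Λ | ∀ (i : Fin n) (j : Fin (κ i)),
          x ((finSigmaFinEquiv ⟨i, j⟩).cast hκ) ∈ A i},
        ENNReal.ofReal (R x) ∂(Measure.pi fun _ : Fin k => μ)

/-- The random point field with law `P` is a Pfaffian point field with kernel `K` with respect to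
`μ`: the kernel is self-dual, and for every `m ≥ 1` the field has an `m`-point correlation function
that is given (almost everywhere, as correlation functions are only defined up to null sets) by the
Moore–Dyson determinant of `(K(x_i, x_j))`. -/
structure IsPfaffianPointField {Λ : Type*} [TopologicalSpace Λ] [MeasurableSpace Λ]
    (μ : Measure Λ) (P : Measure (Configuration Λ)) (K : Λ → Λ → ℍ[ℂ]) : Prop where
  isProbabilityMeasure : IsProbabilityMeasure P
  selfDual : IsSelfDualKernel K
  correlation : ∀ m : ℕ, 1 ≤ m → ∃ R : (Fin m → Λ) → ℝ, IsCorrelationFunction μ P m R ∧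
    ∀ᵐ x ∂(Measure.pi fun _ : Fin m => μ),
      (((R x : ℝ) : ℂ) : ℍ[ℂ]) = mooreDysonDet (Matrix.of fun i j => K (x i) (x j))

/-! ### Kernels with a real diagonal form -/

/-- The series `∑ l_k u_k(x) u_k(y)^*` converges absolutely, with sum `K(x, y)`. -/
def IsDiagonalSumAt {Λ ι : Type*} (K : Λ → Λ → ℍ[ℂ]) (l : ι → ℝ) (u : ι → Λ → ℍ[ℝ])
    (x y : Λ) : Prop :=
  Summable (fun k => ‖l k • (u k x * star (u k y))‖) ∧
    K x y = realQuaternionToComplexified (∑' k, l k • (u k x * star (u k y)))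

/-- The kernel `K` has the real diagonal form `K(x, y) = ∑ l_k u_k(x) u_k(y)^*`, where the `u_k` are
orthonormal real quaternion functions.  The identity holds almost everywhere on `Λ × Λ` and almost
everywhere on the diagonal; the diagonal values matter, because the correlation functions use them,
although the diagonal may be a null set of `Λ × Λ`. -/
structure HasRealDiagonalForm {Λ ι : Type*} [MeasurableSpace Λ] (μ : Measure Λ)
    (K : Λ → Λ → ℍ[ℂ]) (l : ι → ℝ) (u : ι → Λ → ℍ[ℝ]) : Prop where
  memLp : ∀ k, MemLp (u k) 2 μ
  orthonormal : ∀ k k', (k = k' → ∫ x, star (u k x) * u k' x ∂μ = 1) ∧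
    (k ≠ k' → ∫ x, star (u k x) * u k' x ∂μ = 0)
  ae_eq : ∀ᵐ p ∂(μ.prod μ), IsDiagonalSumAt K l u p.1 p.2
  ae_eq_diag : ∀ᵐ x ∂μ, IsDiagonalSumAt K l u x x

/-! The field is a mixture of projection fields. A random index set `I` contains each `k`
independently with probability `λ_k`; since `∑ λ_k < ∞`, it is almost surely finite
(`exists_weights_finset`). Given `I` with `N` elements, `N` points are drawn with density
`Det_M(K_I(x_i, x_j)) / N!`, where `K_I(x, y) = ∑_{k ∈ I} u_k(x) u_k(y)^*`. Orthonormality makes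
`K_I` reproducing, so integrating one point out of an `(n+1)`-point determinant gives `(N - n)`
times the `n`-point one (`lintegral_projectionDet_option`). Hence the density has mass one, and the
`m`-point correlation function given `I` is `Det_M(K_I)`.

Averaging over `I` gives `Det_M(K)` by a Cauchy–Binet formula (`factorial_mul_mooreReal`): `m!`
times the determinant is the sum over index tuples `k` of `∏ λ_{k_i}` times the Gram determinant of
the vectors `(u_{k_i}(x_v))_v`. Tuples with a repetition contribute zero, and for the others `∏
λ_{k_i}` is the probability that all `k_i` lie in `I` (`tsum_weights_projectionDet`).

The algebra rests on a commutative form of the determinant. Reversing a cycle conjugates its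
product, so averaging over reversals replaces every cycle product by its real part, which is half
the trace of the corresponding `2 × 2` complex block (`mooreDysonDet_eq_symplecticDet`). The
resulting `symplecticDet` vanishes when one row is a left multiple of another and the rest is
self-dual (`symplecticDet_eq_zero_of_row`), a consequence of `B + B^* = tr B` for `2 × 2` blocks.
Gram–Schmidt elimination then yields nonnegativity of Gram determinants, so that the densities are
nonnegative and vanish at coincident points. -/

/-! ### Cycles of permutations -/

namespace Equiv.Perm

section Cycles

variable {V W : Type*}

theorem SameCycle.of_forall_apply [Finite V] {σ τ : Perm V}
    (h : ∀ x, σ.SameCycle x (τ x)) {x y : V} (hxy : τ.SameCycle x y) : σ.SameCycle x y := by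
  obtain ⟨i, -, rfl⟩ := hxy.exists_pow_eq'
  induction i with
  | zero => exact SameCycle.refl _ _
  | succ k ih =>
    rw [pow_succ', mul_apply]
    exact (ih ⟨k, by simp⟩).trans (h _)

theorem sameCycle_of_semiconj {σ : Perm V} {τ : Perm W} {f : V → W} (hf : Function.Injective f)
    (h : ∀ x, τ (f x) = f (σ x)) (x y : V) : τ.SameCycle (f x) (f y) ↔ σ.SameCycle x y := by
  have hn : ∀ (n : ℕ) (x : V), (τ ^ n) (f x) = f ((σ ^ n) x) := by
    intro n
    induction n with
    | zero => simp
    | succ k ih => intro x; rw [pow_succ, mul_apply, h, ih, pow_succ, mul_apply]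
  have hz : ∀ (i : ℤ) (x : V), (τ ^ i) (f x) = f ((σ ^ i) x) := by
    intro i x
    cases i with
    | ofNat n => exact hn n x
    | negSucc n =>
      rw [zpow_negSucc, zpow_negSucc, inv_eq_iff_eq, hn]
      simp
  simp only [SameCycle, hz, hf.eq_iff]

/-- The number of cycles of a permutation, fixed points included. -/
noncomputable def cycleCount (σ : Perm V) : ℕ :=
  Nat.card (Quotient (SameCycle.setoid σ))

theorem cycleCount_congr {σ τ : Perm V} (h : ∀ x y, σ.SameCycle x y ↔ τ.SameCycle x y) :
    cycleCount σ = cycleCount τ :=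
  Nat.card_congr (Quotient.congrRight h)

theorem cycleCount_inv (σ : Perm V) : cycleCount σ⁻¹ = cycleCount σ :=
  cycleCount_congr fun _ _ => sameCycle_inv

theorem cycleCount_permCongr (e : V ≃ W) (σ : Perm V) :
    cycleCount (e.permCongr σ) = cycleCount σ :=
  (Nat.card_congr (Quotient.congr e fun x y =>
    (sameCycle_of_semiconj e.injective (by simp [Equiv.permCongr_apply]) x y).symm)).symm

theorem not_sameCycle_optionCongr [Finite V] (σ : Perm V) (x : V) :
    ¬ SameCycle (Equiv.optionCongr σ : Perm (Option V)) none (some x) := by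
  intro h
  obtain ⟨i, -, hi⟩ := h.exists_pow_eq'
  have : ∀ i : ℕ, ((Equiv.optionCongr σ : Perm (Option V)) ^ i) none = none := by
    intro i
    induction i with
    | zero => rfl
    | succ k ih => rw [pow_succ', mul_apply, ih]; simp
  simp [this] at hi

theorem cycleCount_optionCongr [Finite V] (σ : Perm V) :
    cycleCount (Equiv.optionCongr σ : Perm (Option V)) = cycleCount σ + 1 := by
  have hs : ∀ x y, SameCycle (Equiv.optionCongr σ : Perm (Option V)) (some x) (some y) ↔
      σ.SameCycle x y := sameCycle_of_semiconj (Option.some_injective V) (by simp)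
  have hn := not_sameCycle_optionCongr σ
  rw [cycleCount, cycleCount, ← Finite.card_option]
  symm
  refine Nat.card_congr (Equiv.ofBijective (fun q : Option (Quotient (SameCycle.setoid σ)) =>
    match q with
    | none => (Quotient.mk (SameCycle.setoid (Equiv.optionCongr σ : Perm (Option V))) none)
    | some q => Quotient.map some (fun x y h => (hs x y).2 h) q) ⟨?_, ?_⟩)
  · rintro (_ | p) (_ | q) h
    · rfl
    · induction q using Quotient.inductionOn with
      | h y => exact absurd (Quotient.exact h) (hn y)
    · induction p using Quotient.inductionOn with
      | h y => exact absurd (SameCycle.symm (Quotient.exact h)) (hn y)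
    · induction p using Quotient.inductionOn with
      | h x =>
        induction q using Quotient.inductionOn with
        | h y => exact congrArg some (Quotient.sound ((hs x y).1 (Quotient.exact h)))
  · intro q
    induction q using Quotient.inductionOn with
    | h y =>
      cases y with
      | none => exact ⟨none, rfl⟩
      | some y => exact ⟨some (Quotient.mk _ y), rfl⟩

variable [DecidableEq V]

/-- The new permutation sends `a` to `σ b` and then follows `σ`, whose orbit through `b` never meets
`a`, until it reaches `b`. -/
theorem sameCycle_mul_swap [Finite V] {σ : Perm V} {a b : V} (h : ¬ σ.SameCycle a b) :
    (σ * Equiv.swap a b).SameCycle a b := by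
  have hb : ∀ n : ℕ, (σ * Equiv.swap a b).SameCycle a ((σ ^ (n + 1)) b) ∨
      (σ * Equiv.swap a b).SameCycle a b := by
    intro n
    induction n with
    | zero => exact Or.inl ⟨1, by simp⟩
    | succ k ih =>
      rcases ih with ih | ih
      · by_cases hk : (σ ^ (k + 1)) b = b
        · rw [hk] at ih
          exact Or.inr ih
        · left
          have hka : (σ ^ (k + 1)) b ≠ a := fun e =>
            h (SameCycle.symm ⟨(k + 1 : ℕ), by rw [zpow_natCast]; exact e⟩)
          refine ih.trans ⟨1, ?_⟩
          rw [zpow_one, mul_apply, Equiv.swap_apply_of_ne_of_ne hka hk, pow_succ' _ (k + 1),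
            mul_apply]
      · exact Or.inr ih
  have ho : 0 < orderOf σ := orderOf_pos σ
  have := hb (orderOf σ - 1)
  rw [Nat.sub_add_cancel ho, pow_orderOf_eq_one] at this
  simpa using this

theorem not_sameCycle_mul_swap [Finite V] {σ : Perm V} {a b : V} (hab : a ≠ b)
    (h : σ.SameCycle a b) : ¬ (σ * Equiv.swap a b).SameCycle a b := by
  classical
  have hex : ∃ t : ℕ, 0 < t ∧ (σ ^ t) a = b := by
    obtain ⟨i, -, hi⟩ := h.exists_pow_eq'
    refine ⟨i, Nat.pos_of_ne_zero ?_, hi⟩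
    rintro rfl
    exact hab hi
  obtain ⟨ht, htb⟩ := Nat.find_spec hex
  have hmin := fun m hm => Nat.find_min hex (m := m) hm
  generalize Nat.find hex = t at ht htb hmin
  have hne : ∀ k, 1 ≤ k → k ≤ t → (σ ^ k) a ≠ a := by
    intro k hk hkt e
    have hlt : k ≠ t := by
      rintro rfl
      exact hab (e.symm.trans htb)
    refine hmin (t - k) (by omega) ⟨by omega, ?_⟩
    rw [← htb]
    nth_rewrite 2 [← Nat.sub_add_cancel hkt]
    rw [pow_add, mul_apply, e]
  intro hc
  obtain ⟨i, -, hi⟩ := hc.symm.exists_pow_eq'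
  -- With `t` the first time that `σ ^ t` sends `a` to `b`, the arc `σ a, …, σ ^ t a = b` avoids `a`
  -- and is stable under the new permutation, which sends `b` back to `σ a`.
  have hinv : ∀ i : ℕ, ∃ k, 1 ≤ k ∧ k ≤ t ∧ (σ ^ k) a = ((σ * Equiv.swap a b) ^ i) b := by
    intro i
    induction i with
    | zero => exact ⟨t, ht, le_rfl, htb⟩
    | succ n ih =>
      obtain ⟨k, hk1, hkt, hk⟩ := ih
      rw [pow_succ', mul_apply, ← hk, mul_apply]
      by_cases hkb : (σ ^ k) a = b
      · exact ⟨1, le_rfl, ht, by rw [hkb]; simp⟩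
      · have hlt : k ≠ t := by
          rintro rfl
          exact hkb htb
        refine ⟨k + 1, by omega, by omega, ?_⟩
        rw [Equiv.swap_apply_of_ne_of_ne (hne k hk1 hkt) hkb, pow_succ', mul_apply]
  obtain ⟨k, hk1, hkt, hk⟩ := hinv i
  exact hne k hk1 hkt (hk.trans hi)

theorem sameCycle_mul_swap_iff [Finite V] {σ : Perm V} {a b : V} (h : ¬ σ.SameCycle a b)
    {x y : V} : (σ * Equiv.swap a b).SameCycle x y ↔
      σ.SameCycle x y ∨ ((σ.SameCycle a x ∨ σ.SameCycle b x) ∧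
        (σ.SameCycle a y ∨ σ.SameCycle b y)) := by
  have hab := sameCycle_mul_swap h
  have hstep : ∀ x, (σ * Equiv.swap a b).SameCycle x (σ x) := by
    intro x
    by_cases hxa : x = a
    · subst hxa
      exact hab.trans ⟨1, by simp⟩
    · by_cases hxb : x = b
      · subst hxb
        exact hab.symm.trans ⟨1, by simp⟩
      · exact ⟨1, by simp [Equiv.swap_apply_of_ne_of_ne hxa hxb]⟩
  constructor
  · intro hxy
    obtain ⟨i, -, rfl⟩ := hxy.exists_pow_eq'
    clear hxy
    induction i with
    | zero => exact Or.inl (SameCycle.refl _ _)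
    | succ k ih =>
      rw [pow_succ', mul_apply]
      generalize ((σ * Equiv.swap a b) ^ k) x = z at ih ⊢
      rw [mul_apply]
      by_cases hza : z = a
      · subst hza
        rw [Equiv.swap_apply_left]
        right
        refine ⟨?_, Or.inr (by simp [SameCycle.refl])⟩
        rcases ih with ih | ih
        · exact Or.inl ih.symm
        · exact ih.1
      · by_cases hzb : z = b
        · subst hzb
          rw [Equiv.swap_apply_right]
          right
          refine ⟨?_, Or.inl (by simp [SameCycle.refl])⟩
          rcases ih with ih | ih
          · exact Or.inr ih.symm
          · exact ih.1
        · rw [Equiv.swap_apply_of_ne_of_ne hza hzb]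
          simpa using ih
  · rintro (hxy | ⟨hx, hy⟩)
    · exact hxy.of_forall_apply hstep
    · have hx' : (σ * Equiv.swap a b).SameCycle a x := by
        rcases hx with hx | hx
        · exact hx.of_forall_apply hstep
        · exact hab.trans (hx.of_forall_apply hstep)
      have hy' : (σ * Equiv.swap a b).SameCycle a y := by
        rcases hy with hy | hy
        · exact hy.of_forall_apply hstep
        · exact hab.trans (hy.of_forall_apply hstep)
      exact hx'.symm.trans hy'

theorem cycleCount_mul_swap [Finite V] {σ : Perm V} {a b : V} (h : ¬ σ.SameCycle a b) :
    cycleCount σ = cycleCount (σ * Equiv.swap a b) + 1 := by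
  classical
  -- The class of `b` is the one lost in the merger; the other old classes correspond to the new
  -- ones.
  rw [cycleCount, cycleCount, ← Nat.card_congr (Equiv.optionSubtypeNe
    (Quotient.mk (SameCycle.setoid σ) b)), Finite.card_option]
  congr 1
  have hle : ∀ x y, σ.SameCycle x y → (σ * Equiv.swap a b).SameCycle x y := fun x y hxy =>
    (sameCycle_mul_swap_iff h).2 (Or.inl hxy)
  refine Nat.card_congr (Equiv.ofBijective (fun q => Quotient.map
    (sb := SameCycle.setoid (σ * Equiv.swap a b)) id hle q.1) ⟨?_, ?_⟩)
  · rintro ⟨p, hp⟩ ⟨q, hq⟩ hpq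
    induction p using Quotient.inductionOn with
    | h x =>
      induction q using Quotient.inductionOn with
      | h y =>
        have hx : ¬ σ.SameCycle b x := fun e => hp (Quotient.sound e.symm)
        have hy : ¬ σ.SameCycle b y := fun e => hq (Quotient.sound e.symm)
        have := (sameCycle_mul_swap_iff h).1 (Quotient.exact hpq)
        refine Subtype.ext (Quotient.sound ?_)
        rcases this with this | ⟨h1, h2⟩
        · exact this
        · exact (h1.resolve_right hx).symm.trans (h2.resolve_right hy)
  · intro q
    induction q using Quotient.inductionOn with
    | h y =>
      by_cases hy : σ.SameCycle b y
      · refine ⟨⟨Quotient.mk _ a, fun e => h (Quotient.exact e)⟩, Quotient.sound ?_⟩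
        exact (sameCycle_mul_swap_iff h).2 (Or.inr ⟨Or.inl (SameCycle.refl _ _), Or.inr hy⟩)
      · exact ⟨⟨Quotient.mk _ y, fun e => hy (SameCycle.symm (Quotient.exact e))⟩, rfl⟩

end Cycles

/-! ### Reversal of a single cycle. -/

section ReverseCycle

variable {V : Type*}

open scoped Classical in
/-- The permutation obtained from `σ` by reversing its cycle through `b`. -/
noncomputable def reverseCycle (σ : Perm V) (b : V) : Perm V :=
  σ * ((σ.cycleOf b)⁻¹ * (σ.cycleOf b)⁻¹)

theorem reverseCycle_apply_of_sameCycle {σ : Perm V} {b x : V} (h : σ.SameCycle b x) :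
    reverseCycle σ b x = σ⁻¹ x := by
  classical
  have h1 : ∀ y, σ.SameCycle b y → (σ.cycleOf b)⁻¹ y = σ⁻¹ y := by
    intro y hy
    rw [cycleOf_inv]
    exact SameCycle.cycleOf_apply (sameCycle_inv.2 hy)
  simp only [reverseCycle, mul_apply]
  have h2 : σ.SameCycle b (σ⁻¹ x) := by
    rw [← sameCycle_apply_right]
    simpa using h
  rw [h1 x h, h1 _ h2]
  simp

theorem reverseCycle_apply_of_not_sameCycle {σ : Perm V} {b x : V} (h : ¬ σ.SameCycle b x) :
    reverseCycle σ b x = σ x := by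
  classical
  have h1 : (σ.cycleOf b)⁻¹ x = x := by
    rw [cycleOf_inv]
    exact cycleOf_apply_of_not_sameCycle (fun e => h (sameCycle_inv.1 e))
  simp only [reverseCycle, mul_apply]
  rw [h1, h1]

theorem sameCycle_reverseCycle [Finite V] (σ : Perm V) (b x y : V) :
    (reverseCycle σ b).SameCycle x y ↔ σ.SameCycle x y := by
  constructor
  · intro h
    refine h.of_forall_apply fun z => ?_
    by_cases hz : σ.SameCycle b z
    · rw [reverseCycle_apply_of_sameCycle hz]
      simp [SameCycle.refl]
    · rw [reverseCycle_apply_of_not_sameCycle hz]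
      simp [SameCycle.refl]
  · intro h
    refine h.of_forall_apply fun z => ?_
    by_cases hz : σ.SameCycle b z
    · have hz' : σ.SameCycle b (σ z) := sameCycle_apply_right.2 hz
      have := reverseCycle_apply_of_sameCycle hz'
      exact SameCycle.symm ⟨1, by simpa using this⟩
    · exact ⟨1, by simpa using reverseCycle_apply_of_not_sameCycle hz⟩

theorem cycleCount_reverseCycle [Finite V] (σ : Perm V) (b : V) :
    cycleCount (reverseCycle σ b) = cycleCount σ :=
  cycleCount_congr (sameCycle_reverseCycle σ b)

theorem reverseCycle_involutive [Finite V] (b : V) :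
    Function.Involutive fun σ : Perm V => reverseCycle σ b := by
  intro σ
  ext x
  by_cases hx : σ.SameCycle b x
  · rw [reverseCycle_apply_of_sameCycle ((sameCycle_reverseCycle σ b b x).2 hx), inv_eq_iff_eq,
      reverseCycle_apply_of_sameCycle (sameCycle_apply_right.2 hx)]
    simp
  · rw [reverseCycle_apply_of_not_sameCycle (fun e => hx ((sameCycle_reverseCycle σ b b x).1 e)),
      reverseCycle_apply_of_not_sameCycle hx]

/-- The factor by which `σ` is multiplied is a square, hence even. -/
theorem sign_reverseCycle [Fintype V] [DecidableEq V] (σ : Perm V) (b : V) :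
    sign (reverseCycle σ b) = sign σ := by
  rw [reverseCycle, sign_mul, sign_mul, Int.units_mul_self, mul_one]

end ReverseCycle

end Equiv.Perm

/-! ### The symplectic determinant of a matrix of `2 × 2` blocks -/

section SymplecticDet

open Equiv Equiv.Perm

variable {V W : Type*} [Fintype V] [DecidableEq V] [Fintype W] [DecidableEq W]

/-- The product of the entries `Y i (σ i)`, with row colours `t` and column colours `s`. -/
noncomputable def colorProd (Y : V → V → Matrix Bool Bool ℂ) (σ : Perm V) (s t : V → Bool) : ℂ :=
  ∏ i, Y i (σ i) (t i) (s (σ i))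

/-- The product over the cycles of `σ` of the traces of the products of the blocks along them. -/
noncomputable def colorSum (Y : V → V → Matrix Bool Bool ℂ) (σ : Perm V) : ℂ :=
  ∑ s : V → Bool, colorProd Y σ s s

/-- The weight of a permutation in the symplectic determinant. -/
noncomputable def cycleWeight (σ : Perm V) : ℂ := ((sign σ : ℤ) : ℂ) * (1 / 2) ^ cycleCount σ

/-- The signed sum over permutations of the products of the half traces along the cycles. -/
noncomputable def symplecticDet (Y : V → V → Matrix Bool Bool ℂ) : ℂ :=
  ∑ σ : Perm V, cycleWeight σ * colorSum Y σ

/-- The sign attached to a colour. -/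
def colorSign : Bool → ℂ
  | false => 1
  | true => -1

@[simp] theorem colorSign_false : colorSign false = 1 := rfl
@[simp] theorem colorSign_true : colorSign true = -1 := rfl

theorem colorSign_mul_self (p : Bool) : colorSign p * colorSign p = 1 := by cases p <;> simp

theorem cycleWeight_reverseCycle (σ : Perm V) (b : V) :
    cycleWeight (reverseCycle σ b) = cycleWeight σ := by
  rw [cycleWeight, cycleWeight, sign_reverseCycle, cycleCount_reverseCycle]

/-- Merging two cycles flips the sign and removes one factor `1 / 2`. -/
theorem cycleWeight_mul_swap {σ : Perm V} {a b : V} (h : ¬ σ.SameCycle a b) :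
    cycleWeight (σ * swap a b) = -2 * cycleWeight σ := by
  have hab : a ≠ b := fun e => h (e ▸ SameCycle.refl _ _)
  rw [cycleWeight, cycleWeight, Perm.sign_mul, sign_swap hab, cycleCount_mul_swap h, pow_succ]
  push_cast
  ring

open scoped Classical in
-- On the reversed cycle every entry is replaced by its dual, so row and column colours are
-- exchanged and negated there. The signs from duality are collected in the first product, after
-- shifting the row signs once around the cycle (`h3`).
theorem colorProd_reverseCycle {Y : V → V → Matrix Bool Bool ℂ} {σ : Perm V} {b : V}
    (hY : ∀ i j, σ.SameCycle b i → σ.SameCycle b j → ∀ p q,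
      Y i j p q = colorSign p * colorSign q * Y j i (!q) (!p)) (s t : V → Bool) :
    colorProd Y (reverseCycle σ b) s t =
      (∏ i, if σ.SameCycle b i then colorSign (s i) * colorSign (t i) else 1) *
        colorProd Y σ (fun i => if σ.SameCycle b i then !(t i) else s i)
          (fun i => if σ.SameCycle b i then !(s i) else t i) := by
  have h1 : ∀ i, σ.SameCycle b i → σ.cycleOf b i = σ i := fun i hi => hi.cycleOf_apply
  have h2 : ∀ i, ¬ σ.SameCycle b i → σ.cycleOf b i = i :=
    fun i hi => cycleOf_apply_of_not_sameCycle hi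
  have h3 : (∏ i, if σ.SameCycle b i then colorSign (s i) * colorSign (t i) else 1) =
      ∏ i, if σ.SameCycle b i then colorSign (s i) * colorSign (t (σ i)) else 1 := by
    have e1 : ∀ t' : V → Bool,
        (∏ i, if σ.SameCycle b i then colorSign (s i) * colorSign (t' i) else 1) =
        (∏ i, if σ.SameCycle b i then colorSign (s i) else 1) *
          ∏ i, if σ.SameCycle b i then colorSign (t' i) else 1 := by
      intro t'
      rw [← Finset.prod_mul_distrib]
      refine Finset.prod_congr rfl fun i _ => ?_
      split_ifs <;> simp
    rw [e1 t, e1 fun i => t (σ i),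
      ← Equiv.prod_comp (σ.cycleOf b) fun i => if σ.SameCycle b i then colorSign (t i) else 1]
    congr 1
    refine Finset.prod_congr rfl fun i _ => ?_
    by_cases hi : σ.SameCycle b i
    · rw [h1 i hi, if_pos hi, if_pos (sameCycle_apply_right.2 hi)]
    · rw [h2 i hi, if_neg hi, if_neg hi]
  rw [h3, colorProd, colorProd, ← Finset.prod_mul_distrib, ← Equiv.prod_comp (σ.cycleOf b)]
  refine Finset.prod_congr rfl fun i _ => ?_
  by_cases hi : σ.SameCycle b i
  · have hi' : σ.SameCycle b (σ i) := sameCycle_apply_right.2 hi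
    have hr : reverseCycle σ b (σ i) = i := by
      rw [reverseCycle_apply_of_sameCycle hi']
      simp
    rw [h1 i hi, hr, hY _ _ hi' hi]
    simp only [if_pos hi, if_pos hi']
    ring
  · have hi' : ¬ σ.SameCycle b (σ i) := fun e => hi (sameCycle_apply_right.1 e)
    rw [h2 i hi, reverseCycle_apply_of_not_sameCycle hi]
    simp only [if_neg hi, if_neg hi', one_mul]

theorem sum_update_bool (b : V) (f : (V → Bool) → ℂ) :
    ∑ s : V → Bool, ∑ β, f (Function.update s b β) = 2 * ∑ s : V → Bool, f s := by
  have hinv : Function.Involutive fun s : V → Bool => Function.update s b (!(s b)) := by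
    intro s
    simp
  have h : ∑ s : V → Bool, f (Function.update s b (!(s b))) = ∑ s : V → Bool, f s :=
    Equiv.sum_comp (hinv.toPerm _) f
  rw [two_mul]
  nth_rewrite 2 [← h]
  rw [← Finset.sum_add_distrib]
  refine Finset.sum_congr rfl fun s _ => ?_
  have h1 : f s = f (Function.update s b (s b)) := by rw [Function.update_eq_self]
  rw [h1, Fintype.sum_bool]
  cases s b <;> simp [add_comm]

/-! ### Vanishing of the determinant for proportional rows. -/

section Vanishing

variable {Y : V → V → Matrix Bool Bool ℂ} {a b : V} {C : Matrix Bool Bool ℂ}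

/-- Pulling `C` out leaves a matrix whose rows `a` and `b` coincide, with a free row colour `q` at
`a`. -/
theorem colorSum_eq_of_row (hrow : ∀ j p r, Y a j p r = ∑ q, C p q * Y b j q r)
    (σ : Perm V) : colorSum Y σ = ∑ s : V → Bool, ∑ q, C (s a) q *
      colorProd (Function.update Y a (Y b)) σ s (Function.update s a q) := by
  refine Finset.sum_congr rfl fun s _ => ?_
  rw [colorProd, ← Finset.mul_prod_erase _ _ (Finset.mem_univ a), hrow, Finset.sum_mul]
  refine Finset.sum_congr rfl fun q _ => ?_
  rw [colorProd, ← Finset.mul_prod_erase _ _ (Finset.mem_univ a)]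
  simp only [Function.update_self, mul_assoc]
  congr 2
  refine Finset.prod_congr rfl fun i hi => ?_
  rw [Function.update_of_ne (Finset.ne_of_mem_erase hi),
    Function.update_of_ne (Finset.ne_of_mem_erase hi)]

/-- Rows `a` and `b` now being equal, the transposition only exchanges their row colours. -/
theorem colorProd_mul_swap (hab : a ≠ b) (σ : Perm V) (s : V → Bool) (q : Bool) :
    colorProd (Function.update Y a (Y b)) (σ * swap a b) s (Function.update s a q) =
      colorProd (Function.update Y a (Y b)) σ s
        (Function.update (Function.update s a (s b)) b q) := by
  rw [colorProd, colorProd, ← Equiv.prod_comp (swap a b)]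
  refine Finset.prod_congr rfl fun i _ => ?_
  by_cases hia : i = a
  · subst hia
    simp [hab, hab.symm]
  · by_cases hib : i = b
    · subst hib
      simp [hab.symm]
    · simp [swap_apply_of_ne_of_ne hia hib, hia, hib]

/-- Let `C A'` and `B` be the block products along the cycles of `a` and `b`. Up to the common
factor from the other cycles, the three terms are `tr(C A') tr B`, `tr(C B A')` and `tr(C B^* A')`,
so the identity is `B + B^* = tr B`. Self-duality is only needed along the cycle of `b`, which
avoids `a`. -/
theorem colorSum_sub_mul_swap (hrow : ∀ j p r, Y a j p r = ∑ q, C p q * Y b j q r)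
    (hY : ∀ i j, i ≠ a → j ≠ a → ∀ p q,
      Y i j p q = colorSign p * colorSign q * Y j i (!q) (!p))
    {σ : Perm V} (h : ¬ σ.SameCycle a b) :
    colorSum Y σ - colorSum Y (σ * swap a b) = colorSum Y (reverseCycle σ b * swap a b) := by
  classical
  have hab : a ≠ b := fun e => h (e ▸ SameCycle.refl _ _)
  have hne : ∀ i, σ.SameCycle b i → i ≠ a := by
    rintro i hi rfl
    exact h hi.symm
  have hba : ¬ σ.SameCycle b a := fun e => h e.symm
  set Z := Function.update Y a (Y b) with hZ
  have hZY : ∀ i j, σ.SameCycle b i → σ.SameCycle b j → ∀ p q,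
      Z i j p q = colorSign p * colorSign q * Z j i (!q) (!p) := by
    intro i j hi hj p q
    rw [hZ, Function.update_of_ne (hne i hi), Function.update_of_ne (hne j hj)]
    exact hY i j (hne i hi) (hne j hj) p q
  have hrev : colorSum Y (reverseCycle σ b * swap a b) = ∑ x : V → Bool, ∑ q, C (x a) q *
      (colorSign (x b) * colorSign q * colorProd Z σ (Function.update x b (!q))
        (Function.update (Function.update x b (!(x b))) a (x b))) := by
    rw [colorSum_eq_of_row hrow]
    -- Flipping the summed colours on the cycle of `b`, except at `b`, undoes the negations caused
    -- by the reversal.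
    have hinv : Function.Involutive fun (x : V → Bool) (i : V) =>
        if σ.SameCycle b i ∧ i ≠ b then !(x i) else x i := by
      intro x
      funext i
      by_cases hi : σ.SameCycle b i ∧ i ≠ b <;> simp [hi]
    rw [← Equiv.sum_comp (hinv.toPerm _)]
    refine Finset.sum_congr rfl fun x _ => Finset.sum_congr rfl fun q _ => ?_
    have hxa : hinv.toPerm _ x a = x a := by
      simp [hba]
    have hxb : hinv.toPerm _ x b = x b := by
      simp
    rw [colorProd_mul_swap hab, ← hZ, colorProd_reverseCycle hZY, hxa, hxb]
    congr 2
    · rw [← Finset.mul_prod_erase _ _ (Finset.mem_univ b), if_pos (SameCycle.refl _ _),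
        Finset.prod_eq_one, mul_one, hxb, Function.update_self]
      intro i hi
      have hib := Finset.ne_of_mem_erase hi
      split_ifs with hc
      · rw [Function.update_of_ne hib, Function.update_of_ne (hne i hc), colorSign_mul_self]
      · rfl
    · congr 1
      · funext i
        by_cases hib : i = b
        · subst hib
          simp [SameCycle.refl]
        · by_cases hc : σ.SameCycle b i
          · simp [hc, hib, hne i hc]
          · simp [hc, hib]
      · funext i
        by_cases hib : i = b
        · subst hib
          simp [SameCycle.refl, hab.symm]
        · by_cases hc : σ.SameCycle b i
          · simp [hc, hib, hne i hc]
          · by_cases hia : i = a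
            · subst hia
              simp [hc, hib]
            · simp [hc, hib, hia]
  rw [hrev, colorSum_eq_of_row hrow, colorSum_eq_of_row hrow, ← hZ, ← Finset.sum_sub_distrib]
  -- After doubling, each colouring `x` carries its own sum over the colour at `b`, and the identity
  -- holds for each `x` separately.
  refine mul_left_cancel₀ (two_ne_zero' ℂ) ?_
  rw [← sum_update_bool b, ← sum_update_bool b]
  refine Finset.sum_congr rfl fun x _ => ?_
  have hc1 : ∀ p r : Bool, Function.update (Function.update x b r) a p =
      Function.update (Function.update x a p) b r := fun p r =>
    Function.update_comm hab.symm _ _ _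
  simp only [hZ, colorProd_mul_swap hab]
  simp only [← hZ, hc1, Fintype.sum_bool, Function.update_self, Function.update_of_ne hab,
    Function.update_idem, Bool.not_true, Bool.not_false, colorSign_true, colorSign_false]
  ring

/-- The symplectic determinant vanishes if a row is a left multiple of another row. -/
theorem symplecticDet_eq_zero_of_row (hab : a ≠ b)
    (hrow : ∀ j p r, Y a j p r = ∑ q, C p q * Y b j q r)
    (hY : ∀ i j, i ≠ a → j ≠ a → ∀ p q,
      Y i j p q = colorSign p * colorSign q * Y j i (!q) (!p)) :
    symplecticDet Y = 0 := by
  classical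
  -- Multiplication by `swap a b` matches the permutations separating `a` from `b` with those
  -- joining them.
  have hsplit : symplecticDet Y =
      ∑ σ : Perm V with ¬ σ.SameCycle a b, (cycleWeight σ * colorSum Y σ +
        cycleWeight (σ * swap a b) * colorSum Y (σ * swap a b)) := by
    rw [symplecticDet, Finset.sum_add_distrib,
      ← Finset.sum_filter_not_add_sum_filter _ (fun σ : Perm V => σ.SameCycle a b)]
    congr 1
    refine (Finset.sum_nbij' (fun σ => σ * swap a b) (fun σ => σ * swap a b) ?_ ?_ ?_ ?_ ?_).symm
    · intro σ hσ
      simp only [Finset.mem_filter, Finset.mem_univ, true_and] at hσ ⊢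
      exact sameCycle_mul_swap hσ
    · intro σ hσ
      simp only [Finset.mem_filter, Finset.mem_univ, true_and] at hσ ⊢
      exact not_sameCycle_mul_swap hab hσ
    · intro σ _
      simp [mul_assoc]
    · intro σ _
      simp [mul_assoc]
    · intro σ _
      rfl
  have hinv : ∑ σ : Perm V with ¬ σ.SameCycle a b, cycleWeight σ * colorSum Y (σ * swap a b) =
      ∑ σ : Perm V with ¬ σ.SameCycle a b,
        cycleWeight σ * colorSum Y (reverseCycle σ b * swap a b) := by
    refine Finset.sum_nbij' (fun σ => reverseCycle σ b) (fun σ => reverseCycle σ b) ?_ ?_ ?_ ?_ ?_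
    · intro σ hσ
      simpa [sameCycle_reverseCycle] using hσ
    · intro σ hσ
      simpa [sameCycle_reverseCycle] using hσ
    · intro σ _
      exact reverseCycle_involutive b σ
    · intro σ _
      exact reverseCycle_involutive b σ
    · intro σ _
      rw [cycleWeight_reverseCycle]
      congr 3
      exact (reverseCycle_involutive b σ).symm
  -- The weight `-2` is split in two: one copy combines with `colorSum Y σ` into the sum for the
  -- reversed cycle, and the other cancels that sum, because reversal permutes the index set and
  -- preserves weights.
  have h0 : symplecticDet Y = ∑ σ : Perm V with ¬ σ.SameCycle a b,
      (cycleWeight σ * (colorSum Y σ - colorSum Y (σ * swap a b)) -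
        cycleWeight σ * colorSum Y (σ * swap a b)) := by
    rw [hsplit]
    refine Finset.sum_congr rfl fun σ hσ => ?_
    rw [cycleWeight_mul_swap (Finset.mem_filter.1 hσ).2]
    ring
  rw [h0, Finset.sum_sub_distrib, hinv, sub_eq_zero]
  refine Finset.sum_congr rfl fun σ hσ => ?_
  rw [colorSum_sub_mul_swap hrow hY (Finset.mem_filter.1 hσ).2]

end Vanishing

end SymplecticDet

/-! ### Reindexing, duality, expansion along an element, and Cauchy–Binet. -/

section SymplecticDetRecursion

open Equiv Equiv.Perm

variable {V W : Type*} [Fintype V] [DecidableEq V] [Fintype W] [DecidableEq W]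

theorem cycleWeight_permCongr (e : V ≃ W) (σ : Perm V) :
    cycleWeight (e.permCongr σ) = cycleWeight σ := by
  rw [cycleWeight, cycleWeight, cycleCount_permCongr, sign_permCongr]

theorem symplecticDet_reindex (e : V ≃ W) (Y : W → W → Matrix Bool Bool ℂ) :
    symplecticDet (fun i j => Y (e i) (e j)) = symplecticDet Y := by
  rw [symplecticDet, symplecticDet, ← Equiv.sum_comp e.permCongr]
  refine Finset.sum_congr rfl fun σ _ => ?_
  rw [cycleWeight_permCongr, colorSum, colorSum,
    ← Equiv.sum_comp (e.arrowCongr (Equiv.refl Bool))]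
  congr 1
  refine Finset.sum_congr rfl fun s _ => ?_
  rw [colorProd, colorProd, ← Equiv.prod_comp e]
  simp [Equiv.permCongr_apply]

theorem cycleWeight_inv (σ : Perm V) : cycleWeight σ⁻¹ = cycleWeight σ := by
  rw [cycleWeight, cycleWeight, cycleCount_inv, sign_inv]

/-- The symplectic determinant is invariant under the quaternionic transposition. -/
theorem symplecticDet_dual {Y Y' : V → V → Matrix Bool Bool ℂ}
    (h : ∀ i j p q, Y' i j p q = colorSign p * colorSign q * Y j i (!q) (!p)) :
    symplecticDet Y' = symplecticDet Y := by
  rw [symplecticDet, symplecticDet, ← Equiv.sum_comp (Equiv.inv (Perm V))]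
  refine Finset.sum_congr rfl fun σ _ => ?_
  rw [Equiv.inv_apply, cycleWeight_inv, colorSum, colorSum]
  congr 1
  have hinv : Function.Involutive fun (x : V → Bool) (i : V) => !(x i) := by
    intro x
    simp
  rw [← Equiv.sum_comp (hinv.toPerm _)]
  refine Finset.sum_congr rfl fun s _ => ?_
  have hs : (∏ i, colorSign (!(s i))) * (∏ i, colorSign (!(s (σ i)))) = 1 := by
    rw [Equiv.prod_comp σ fun i => colorSign (!(s i)), ← Finset.prod_mul_distrib]
    simp [colorSign_mul_self]
  rw [colorProd, colorProd, ← Equiv.prod_comp σ]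
  have hσ : ∀ x, σ⁻¹ (σ x) = x := fun x => by simp
  simp only [h, Function.Involutive.coe_toPerm, hσ, Bool.not_not,
    Finset.prod_mul_distrib]
  rw [mul_comm (∏ i, colorSign (!(s (σ i)))), hs, one_mul]

theorem cycleWeight_optionCongr (σ : Perm V) :
    cycleWeight (Equiv.optionCongr σ : Perm (Option V)) = 1 / 2 * cycleWeight σ := by
  rw [cycleWeight, cycleWeight, cycleCount_optionCongr, optionCongr_sign, pow_succ]
  ring

/-- A permutation of `Option V` either fixes `none` or arises by inserting `none` between `a` and `π
a` in a cycle of `π`. -/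
theorem sum_perm_option {M : Type*} [AddCommMonoid M] (f : Perm (Option V) → M) :
    ∑ σ, f σ = ∑ π : Perm V, (f (Equiv.optionCongr π) +
      ∑ a, f ((Equiv.optionCongr π : Perm (Option V)) * swap none (some a))) := by
  rw [← Equiv.sum_comp decomposeOption.symm, Fintype.sum_prod_type_right]
  refine Finset.sum_congr rfl fun π _ => ?_
  rw [Fintype.sum_option]
  congr 1
  · congr 1
    ext1 x
    simp [decomposeOption_symm_apply]
  -- `decomposeOption` records the image of `none`, which is `π a`, and puts the transposition on
  -- the left; conjugating by `π` moves it to the right.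
  · rw [← Equiv.sum_comp π]
    refine Finset.sum_congr rfl fun a _ => ?_
    congr 1
    ext1 x
    cases x with
    | none => simp [decomposeOption_symm_apply]
    | some x =>
      by_cases hx : x = a
      · subst hx
        simp [decomposeOption_symm_apply]
      · have h1 : some (π x) ≠ some (π a) := by simpa using hx
        have h2 : some x ≠ some a := by simpa using hx
        simp only [decomposeOption_symm_apply, Perm.mul_apply, Equiv.optionCongr_apply,
          Option.map_some]
        rw [swap_apply_of_ne_of_ne (by simp) h1, swap_apply_of_ne_of_ne (by simp) h2]
        simp

/-- Expansion of the symplectic determinant with respect to the cycle through an element. -/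
theorem symplecticDet_option (Y : Option V → Option V → Matrix Bool Bool ℂ) :
    symplecticDet Y =
      (1 / 2 * (Y none none).trace) * symplecticDet (fun i j : V => Y (some i) (some j)) -
      ∑ π : Perm V, cycleWeight π * ∑ a, ∑ s : V → Bool,
        (∏ i ∈ Finset.univ.erase a, Y (some i) (some (π i)) (s i) (s (π i))) *
          (Y (some a) none * Y none (some (π a))) (s a) (s (π a)) := by
  have hsum : ∀ f : (Option V → Bool) → ℂ, ∑ s, f s = ∑ p : Bool, ∑ s : V → Bool,
      f (fun o => o.elim p s) := by
    intro f
    rw [← Fintype.sum_prod_type', ← Equiv.sum_comp (Equiv.piOptionEquivProd).symm]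
    refine Finset.sum_congr rfl fun x _ => ?_
    congr 1
    funext o
    cases o <;> rfl
  rw [symplecticDet, sum_perm_option, Finset.sum_add_distrib, sub_eq_add_neg]
  congr 1
  · rw [symplecticDet, Finset.mul_sum]
    refine Finset.sum_congr rfl fun π _ => ?_
    rw [cycleWeight_optionCongr, colorSum, hsum, colorSum, Matrix.trace]
    simp only [colorProd, Fintype.prod_option, Equiv.optionCongr_apply, Option.map_none,
      Option.map_some, Option.elim_none, Option.elim_some, Matrix.diag_apply]
    simp only [← Finset.mul_sum]
    rw [← Finset.sum_mul]
    ring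
  · rw [← Finset.sum_neg_distrib]
    refine Finset.sum_congr rfl fun π _ => ?_
    rw [Finset.mul_sum, ← Finset.sum_neg_distrib]
    refine Finset.sum_congr rfl fun a _ => ?_
    -- The factor `-2` from merging and the `1 / 2` of the fixed point `none` combine to `-1`.
    rw [cycleWeight_mul_swap (not_sameCycle_optionCongr π a), cycleWeight_optionCongr,
      colorSum, hsum, Finset.sum_comm]
    have : ∀ s : V → Bool, ∑ p : Bool, colorProd Y
        ((Equiv.optionCongr π : Perm (Option V)) * swap none (some a))
        (fun o => o.elim p s) (fun o => o.elim p s) =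
        (∏ i ∈ Finset.univ.erase a, Y (some i) (some (π i)) (s i) (s (π i))) *
          (Y (some a) none * Y none (some (π a))) (s a) (s (π a)) := by
      intro s
      rw [Matrix.mul_apply, Finset.mul_sum]
      refine Finset.sum_congr rfl fun p _ => ?_
      rw [colorProd, Fintype.prod_option, ← Finset.mul_prod_erase _ _ (Finset.mem_univ a)]
      have hp : ∀ i ∈ Finset.univ.erase a,
          ((Equiv.optionCongr π : Perm (Option V)) * swap none (some a)) (some i) =
            some (π i) := by
        intro i hi
        have : some i ≠ some a := by simpa using Finset.ne_of_mem_erase hi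
        rw [Perm.mul_apply, swap_apply_of_ne_of_ne (by simp) this]
        simp
      rw [Finset.prod_congr rfl fun i hi => by rw [hp i hi]]
      simp
      ring
    rw [Finset.sum_congr rfl fun s _ => this s]
    ring

/-- The symplectic determinant with a row and a column split off. -/
theorem symplecticDet_option_of_zero {Y : Option V → Option V → Matrix Bool Bool ℂ}
    (h : ∀ j, Y (some j) none = 0) :
    symplecticDet Y =
      (1 / 2 * (Y none none).trace) * symplecticDet (fun i j : V => Y (some i) (some j)) := by
  rw [symplecticDet_option]
  simp [h]

theorem symplecticDet_of_isEmpty [IsEmpty V] (Y : V → V → Matrix Bool Bool ℂ) :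
    symplecticDet Y = 1 := by
  have h : ∀ σ : Perm V, cycleCount σ = 0 := fun σ => by
    rw [cycleCount]
    exact Nat.card_of_isEmpty
  simp [symplecticDet, cycleWeight, h, colorSum, colorProd]

/-- The Cauchy–Binet identity, in the form of an exchange of the two index sets. -/
theorem sum_symplecticDet_comp {κ U : Type*} [Fintype U] [DecidableEq κ] (F : Finset κ) (c : κ → ℂ)
    (A : U → κ → Matrix Bool Bool ℂ) (B : κ → U → Matrix Bool Bool ℂ) :
    ∑ f : W → U, symplecticDet (fun i j => ∑ k ∈ F, c k • (A (f i) k * B k (f j))) =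
      ∑ k ∈ Fintype.piFinset fun _ : W => F, (∏ i, c (k i)) *
        symplecticDet (fun i j => ∑ v, B (k i) v * A v (k j)) := by
  simp only [symplecticDet, Finset.mul_sum]
  rw [Finset.sum_comm, Finset.sum_comm (s := Fintype.piFinset fun _ : W => F)]
  refine Finset.sum_congr rfl fun σ _ => ?_
  simp only [mul_left_comm _ (cycleWeight σ), ← Finset.mul_sum]
  congr 1
  simp only [colorSum, colorProd]
  have h1 : ∀ (f : W → U) (s : W → Bool), ∏ i, (∑ k ∈ F, c k • (A (f i) k * B k (f (σ i))))
      (s i) (s (σ i)) = ∑ k ∈ Fintype.piFinset fun _ : W => F, ∑ r : W → Bool,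
        (∏ i, c (k i)) * ((∏ i, A (f i) (k i) (s i) (r i)) *
          ∏ i, B (k i) (f (σ i)) (r i) (s (σ i))) := by
    intro f s
    simp only [Matrix.sum_apply, Matrix.smul_apply, Matrix.mul_apply, smul_eq_mul]
    rw [Finset.prod_univ_sum]
    refine Finset.sum_congr rfl fun k _ => ?_
    rw [Finset.prod_mul_distrib, Finset.prod_univ_sum, Fintype.piFinset_univ, Finset.mul_sum]
    simp only [Finset.prod_mul_distrib]
  have h2 : ∀ (k : W → κ) (r : W → Bool), ∏ i, (∑ v, B (k i) v * A v (k (σ i)))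
      (r i) (r (σ i)) = ∑ f : W → U, ∑ s : W → Bool,
        (∏ i, A (f i) (k i) (s i) (r i)) * ∏ i, B (k i) (f (σ i)) (r i) (s (σ i)) := by
    intro k r
    simp only [Matrix.sum_apply, Matrix.mul_apply]
    rw [Finset.prod_univ_sum, Fintype.piFinset_univ,
      -- Cyclicity of the trace: the index between `k i` and `k (σ i)` is renamed `f (σ i)`, so both
      -- sides run over the same closed paths.
      ← Equiv.sum_comp (σ.symm.arrowCongr (Equiv.refl U))]
    refine Finset.sum_congr rfl fun f _ => ?_
    rw [Finset.prod_univ_sum, Fintype.piFinset_univ,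
      ← Equiv.sum_comp (σ.symm.arrowCongr (Equiv.refl Bool))]
    refine Finset.sum_congr rfl fun s _ => ?_
    rw [← Equiv.prod_comp σ fun i => A (f i) (k i) (s i) (r i), ← Finset.prod_mul_distrib]
    refine Finset.prod_congr rfl fun i _ => ?_
    simp [mul_comm]
  simp only [h1, h2, Finset.mul_sum]
  rw [Finset.sum_congr rfl fun f _ => Finset.sum_comm, Finset.sum_comm]
  refine Finset.sum_congr rfl fun k _ => ?_
  rw [Finset.sum_congr rfl fun f _ => Finset.sum_comm, Finset.sum_comm]

/-- A non-injective `f` repeats a row and contributes zero; the `n!` injective ones are reindexings.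
-/
theorem sum_symplecticDet_comp_self {Y : V → V → Matrix Bool Bool ℂ}
    (hY : ∀ i j p q, Y i j p q = colorSign p * colorSign q * Y j i (!q) (!p)) :
    ∑ f : V → V, symplecticDet (fun i j => Y (f i) (f j)) =
      (Fintype.card V).factorial * symplecticDet Y := by
  have h0 : ∀ f : V → V, ¬ Function.Injective f →
      symplecticDet (fun i j => Y (f i) (f j)) = 0 := by
    intro f hf
    simp only [Function.Injective, not_forall] at hf
    obtain ⟨a, b, hab, hne⟩ := hf
    refine symplecticDet_eq_zero_of_row (C := 1) hne (fun j p r => ?_)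
      (fun i j _ _ p q => hY _ _ p q)
    simp [Matrix.one_apply, hab]
  classical
  rw [← Finset.sum_filter_add_sum_filter_not _ (fun f : V → V => Function.Injective f),
    Finset.sum_eq_zero (s := Finset.univ.filter fun f : V → V => ¬ Function.Injective f)
      fun f hf => h0 f (Finset.mem_filter.1 hf).2, add_zero]
  have h1 : ∀ f ∈ Finset.univ.filter fun f : V → V => Function.Injective f,
      symplecticDet (fun i j => Y (f i) (f j)) = symplecticDet Y := by
    intro f hf
    have hf := (Finset.mem_filter.1 hf).2
    exact symplecticDet_reindex (Equiv.ofBijective f (Finite.injective_iff_bijective.1 hf)) Y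
  rw [Finset.sum_congr rfl h1, Finset.sum_const, nsmul_eq_mul]
  congr 2
  rw [← Fintype.card_subtype, Fintype.card_congr (Equiv.subtypeInjectiveEquivEmbedding V V),
    Fintype.card_embedding_eq, Nat.descFactorial_self]

end SymplecticDetRecursion

/-! ### Quaternionic Gram matrices -/

section Gram

open Equiv Equiv.Perm
open scoped ComplexOrder

/-- The representation of the real quaternions by complex `2 × 2` matrices. -/
noncomputable def quaternionMatrix : ℍ[ℝ] →ₐ[ℝ] Matrix Bool Bool ℂ :=
  AlgHom.ofLinearMap
    { toFun := fun q => Matrix.of fun p r =>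
        match p, r with
        | false, false => ⟨q.re, q.imI⟩
        | false, true => ⟨q.imJ, q.imK⟩
        | true, false => ⟨-q.imJ, q.imK⟩
        | true, true => ⟨q.re, -q.imI⟩
      map_add' := by
        intro x y
        ext p r
        cases p <;> cases r <;> simp [Complex.ext_iff, add_comm]
      map_smul' := by
        intro c x
        ext p r
        cases p <;> cases r <;> simp [Complex.ext_iff] }
    (by
      ext p r
      cases p <;> cases r <;> simp [Complex.ext_iff])
    (by
      intro x y
      ext p r
      cases p <;> cases r <;>
        simp [Complex.ext_iff, Matrix.mul_apply, Quaternion.re_mul, Quaternion.imI_mul,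
          Quaternion.imJ_mul, Quaternion.imK_mul] <;> constructor <;> ring)

theorem quaternionMatrix_star (q : ℍ[ℝ]) (p r : Bool) :
    quaternionMatrix (star q) p r =
      colorSign p * colorSign r * quaternionMatrix q (!r) (!p) := by
  cases p <;> cases r <;> simp [quaternionMatrix, Complex.ext_iff]

theorem trace_quaternionMatrix (q : ℍ[ℝ]) :
    (quaternionMatrix q).trace = 2 * (q.re : ℂ) := by
  simp [quaternionMatrix, Complex.ext_iff, Matrix.trace]
  ring

variable {V κ : Type*} [Fintype V] [DecidableEq V] [Fintype κ]

/-- The matrix of the products `l_i^* r_j`, with quaternions represented by `2 × 2` blocks. -/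
noncomputable def crossGram (l r : V → κ → ℍ[ℝ]) (i j : V) : Matrix Bool Bool ℂ :=
  quaternionMatrix (∑ c, star (l i c) * r j c)

omit [Fintype V] [DecidableEq V] in
theorem crossGram_dual (l r : V → κ → ℍ[ℝ]) (i j : V) (p q : Bool) :
    crossGram l r i j p q = colorSign p * colorSign q * crossGram r l j i (!q) (!p) := by
  rw [crossGram, crossGram, ← quaternionMatrix_star, star_sum]
  simp

theorem symplecticDet_crossGram_comm (l r : V → κ → ℍ[ℝ]) :
    symplecticDet (crossGram l r) = symplecticDet (crossGram r l) :=
  symplecticDet_dual (crossGram_dual l r)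

theorem symplecticDet_add_row {Y Y₁ Y₂ : V → V → Matrix Bool Bool ℂ} (a : V)
    (ha : ∀ j, Y a j = Y₁ a j + Y₂ a j) (h₁ : ∀ i, i ≠ a → Y i = Y₁ i)
    (h₂ : ∀ i, i ≠ a → Y i = Y₂ i) :
    symplecticDet Y = symplecticDet Y₁ + symplecticDet Y₂ := by
  simp only [symplecticDet, colorSum, ← Finset.sum_add_distrib, ← mul_add]
  refine Finset.sum_congr rfl fun σ _ => ?_
  congr 1
  refine Finset.sum_congr rfl fun s _ => ?_
  simp only [colorProd, ← Finset.mul_prod_erase _ _ (Finset.mem_univ a)]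
  rw [ha, Matrix.add_apply, add_mul]
  congr 2 <;> refine Finset.prod_congr rfl fun i hi => ?_
  · rw [h₁ i (Finset.ne_of_mem_erase hi)]
  · rw [h₂ i (Finset.ne_of_mem_erase hi)]

/-- Row `a` is `star c` times row `b`. The right family `r` may differ from `w` at `a`, since
self-duality is only required off `a`. -/
theorem symplecticDet_crossGram_eq_zero {w r : V → κ → ℍ[ℝ]} {a b : V} (hab : a ≠ b)
    (hr : ∀ i, i ≠ a → r i = w i) (c : ℍ[ℝ]) :
    symplecticDet (crossGram (Function.update w a fun k => w b k * c) r) = 0 := by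
  refine symplecticDet_eq_zero_of_row (C := quaternionMatrix (star c)) hab ?_ ?_
  · intro j p q
    rw [← Matrix.mul_apply, crossGram, crossGram, ← map_mul, Function.update_self,
      Function.update_of_ne hab.symm, Finset.mul_sum]
    simp [mul_assoc]
  · intro i j hi hj p q
    rw [crossGram_dual]
    simp only [crossGram, hr i hi, hr j hj, Function.update_of_ne hi, Function.update_of_ne hj]

/-- The operation is performed on the left family with the right one fixed, then, after dualizing,
on the other; `key` therefore allows any right family that agrees with `w` off `a`. -/
theorem symplecticDet_crossGram_update (w : V → κ → ℍ[ℝ]) {a b : V} (hab : a ≠ b) (c : ℍ[ℝ]) :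
    symplecticDet (crossGram (Function.update w a fun k => w a k + w b k * c)
      (Function.update w a fun k => w a k + w b k * c)) = symplecticDet (crossGram w w) := by
  have key : ∀ r : V → κ → ℍ[ℝ], (∀ i, i ≠ a → r i = w i) →
      symplecticDet (crossGram (Function.update w a fun k => w a k + w b k * c) r) =
        symplecticDet (crossGram w r) := by
    intro r hr
    rw [symplecticDet_add_row (Y₁ := crossGram w r)
      (Y₂ := crossGram (Function.update w a fun k => w b k * c) r) a,
      symplecticDet_crossGram_eq_zero hab hr, add_zero]
    · intro j
      simp only [crossGram]
      rw [← map_add, ← Finset.sum_add_distrib]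
      simp [add_mul]
    · intro i hi
      funext j
      simp [crossGram, hi]
    · intro i hi
      funext j
      simp [crossGram, hi]
  rw [key _ fun i hi => by simp [hi], symplecticDet_crossGram_comm, key _ fun i hi => rfl]

theorem symplecticDet_crossGram_of_eq {w : V → κ → ℍ[ℝ]} {a b : V} (hab : a ≠ b)
    (h : w a = w b) : symplecticDet (crossGram w w) = 0 := by
  have := symplecticDet_crossGram_eq_zero (w := w) (r := w) hab (fun _ _ => rfl) 1
  simpa [← h] using this

/-- Gram–Schmidt: making all other vectors orthogonal to `v = w none` preserves the determinant,
which then factors as the squared norm of `v` times a smaller Gram determinant. -/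
theorem symplecticDet_crossGram_nonneg (w : V → κ → ℍ[ℝ]) :
    0 ≤ symplecticDet (crossGram w w) := by
  suffices h : ∀ [DecidableEq V] (w : V → κ → ℍ[ℝ]), 0 ≤ symplecticDet (crossGram w w) from h w
  clear w
  refine Fintype.induction_empty_option (P := fun V _ => ∀ [DecidableEq V] (w : V → κ → ℍ[ℝ]),
    0 ≤ symplecticDet (crossGram w w)) ?_ ?_ ?_ V
  · intro α β _ e ih _ w
    classical
    let _ := Fintype.ofEquiv β e.symm
    have := ih fun i => w (e i)
    rw [← symplecticDet_reindex e]
    exact this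
  · intro _ w
    rw [symplecticDet_of_isEmpty]
    exact zero_le_one
  · intro V _ ih _ w
    classical
    obtain rfl : ‹DecidableEq (Option V)› = fun a b => Option.instDecidableEq a b :=
      Subsingleton.elim _ _
    set v := w none with hv
    set N : ℝ := ∑ k, Quaternion.normSq (v k) with hN
    have hvv : ∑ k, star (v k) * v k = (N : ℍ[ℝ]) := by
      simp only [Quaternion.star_mul_self, hN]
      exact (map_sum (algebraMap ℝ ℍ[ℝ]) _ _).symm
    by_cases hN0 : N = 0
    · have hv0 : ∀ k, v k = 0 := by
        intro k
        have := (Finset.sum_eq_zero_iff_of_nonneg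
          (fun k _ => Quaternion.normSq_nonneg)).1 hN0 k (Finset.mem_univ k)
        exact Quaternion.normSq_eq_zero.1 this
      rw [symplecticDet_option_of_zero]
      · simp [crossGram, ← hv, hv0]
      · intro j
        simp [crossGram, ← hv, hv0]
    -- The Gram–Schmidt coefficients; in `w' S` the vectors with index in `S` have already been
    -- corrected, one elementary operation each.
    · let c : V → ℍ[ℝ] := fun i => -(((N⁻¹ : ℝ) : ℍ[ℝ]) * ∑ k, star (v k) * w (some i) k)
      let w' : Finset V → Option V → κ → ℍ[ℝ] := fun S o =>
        o.elim v fun i => if i ∈ S then fun k => w (some i) k + v k * c i else w (some i)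
      have hS : ∀ S : Finset V, symplecticDet (crossGram (w' S) (w' S)) =
          symplecticDet (crossGram w w) := by
        intro S
        induction S using Finset.induction_on with
        | empty =>
          have : w' ∅ = w := by
            funext o
            cases o <;> simp [w', hv]
          rw [this]
        | insert i S hi ihS =>
          rw [← ihS, ← symplecticDet_crossGram_update (w' S) (a := some i) (b := none)
            (by simp) (c i)]
          have : w' (insert i S) = Function.update (w' S) (some i)
              fun k => w' S (some i) k + w' S none k * c i := by
            funext o
            cases o with
            | none => simp [w']
            | some j =>
              by_cases hj : j = i
              · subst hj
                simp [w', hi]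
              · simp [w', hj]
          rw [this]
      rw [← hS Finset.univ, symplecticDet_option_of_zero]
      · refine mul_nonneg ?_ ?_
        · have : w' Finset.univ none = v := rfl
          rw [crossGram, trace_quaternionMatrix, this, hvv]
          have hN' : 0 ≤ N := Finset.sum_nonneg fun k _ => Quaternion.normSq_nonneg
          simpa using hN'
        · exact ih fun i => w' Finset.univ (some i)
      · intro j
        have h0 : ∑ k, star (v k) * (w (some j) k + v k * c j) = 0 := by
          simp only [mul_add, ← mul_assoc]
          rw [Finset.sum_add_distrib, ← Finset.sum_mul, hvv]
          simp only [c]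
          rw [mul_neg, ← mul_assoc, ← Quaternion.coe_mul, mul_inv_cancel₀ hN0]
          simp
        have h1 := congrArg star h0
        simp only [star_sum, star_mul, star_star, star_zero] at h1
        simp only [crossGram, w', Option.elim_some, Option.elim_none, Finset.mem_univ, if_true]
        rw [h1, map_zero]

/-- The Moore determinant of the Gram matrix of a family of quaternionic vectors. -/
noncomputable def gramDet (w : V → κ → ℍ[ℝ]) : ℝ := (symplecticDet (crossGram w w)).re

theorem gramDet_nonneg (w : V → κ → ℍ[ℝ]) : 0 ≤ gramDet w :=
  (Complex.nonneg_iff.1 (symplecticDet_crossGram_nonneg w)).1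

theorem coe_gramDet (w : V → κ → ℍ[ℝ]) : (gramDet w : ℂ) = symplecticDet (crossGram w w) :=
  Complex.ext (by simp [gramDet])
    (by simpa using (Complex.nonneg_iff.1 (symplecticDet_crossGram_nonneg w)).2)

theorem gramDet_of_eq {w : V → κ → ℍ[ℝ]} {a b : V} (hab : a ≠ b) (h : w a = w b) :
    gramDet w = 0 := by
  rw [gramDet, symplecticDet_crossGram_of_eq hab h, Complex.zero_re]

theorem gramDet_reindex {W : Type*} [Fintype W] [DecidableEq W] (e : W ≃ V)
    (w : V → κ → ℍ[ℝ]) : gramDet (fun i => w (e i)) = gramDet w := by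
  rw [gramDet, gramDet, ← symplecticDet_reindex e]
  rfl

theorem gramDet_of_isEmpty [IsEmpty V] (w : V → κ → ℍ[ℝ]) : gramDet w = 1 := by
  rw [gramDet, symplecticDet_of_isEmpty, Complex.one_re]

end Gram

/-! ### The Moore–Dyson determinant of a self-dual real quaternion matrix -/

section MooreDyson

open Equiv Equiv.Perm

theorem List.prod_map_filter_eq_ite {α A : Type*} [Monoid A] (l : List α) (p : α → Prop)
    [DecidablePred p] (f : α → A) :
    ((l.filter fun i => p i).map f).prod = (l.map fun i => if p i then f i else 1).prod := by
  induction l with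
  | nil => rfl
  | cons a l ih => by_cases h : p a <;> simp [h, ih]

theorem List.star_prod_map_range {A : Type*} [Ring A] [StarRing A] (p : ℕ) (f : ℕ → A) :
    star ((List.range p).map f).prod = ((List.range p).map fun t => star (f (p - 1 - t))).prod := by
  induction p with
  | zero => simp
  | succ p ih =>
    rw [List.range_succ, List.map_append, List.prod_append, star_mul, ih, ← List.range_succ,
      List.range_succ_eq_map]
    simp only [List.map_cons, List.map_nil, List.map_map, List.prod_cons, List.prod_nil, mul_one]
    congr 3
    funext t
    simp only [Function.comp_apply]
    congr 2
    omega

variable {n : ℕ}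

/-- The element `i` is the largest one of its cycle under `σ`. -/
abbrev IsCycleLeader (σ : Perm (Fin n)) (i : Fin n) : Prop := ∀ j, σ.SameCycle i j → j ≤ i

theorem IsCycleLeader.eq {σ : Perm (Fin n)} {i j : Fin n} (hi : IsCycleLeader σ i)
    (hj : IsCycleLeader σ j) (h : σ.SameCycle i j) : i = j :=
  le_antisymm (hj i h.symm) (hi j h)

theorem exists_isCycleLeader (σ : Perm (Fin n)) (x : Fin n) :
    ∃ i, IsCycleLeader σ i ∧ σ.SameCycle i x := by
  classical
  have hne : (Finset.univ.filter fun j => σ.SameCycle x j).Nonempty :=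
    ⟨x, by simp [SameCycle.refl]⟩
  obtain ⟨i, hi, hmax⟩ := Finset.exists_max_image _ id hne
  simp only [Finset.mem_filter, Finset.mem_univ, true_and, id] at hi hmax
  exact ⟨i, fun j hj => hmax j (hi.trans hj), hi.symm⟩

theorem cycleCount_eq_card_isCycleLeader (σ : Perm (Fin n)) :
    cycleCount σ = Fintype.card {i // IsCycleLeader σ i} := by
  rw [cycleCount, ← Nat.card_eq_fintype_card]
  refine (Nat.card_congr (Equiv.ofBijective
    (fun i : {i // IsCycleLeader σ i} => Quotient.mk (SameCycle.setoid σ) i.1) ⟨?_, ?_⟩)).symm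
  · rintro ⟨i, hi⟩ ⟨j, hj⟩ hij
    exact Subtype.ext (hi.eq hj (Quotient.exact hij))
  · intro q
    induction q using Quotient.inductionOn with
    | h x =>
      obtain ⟨i, hi, hix⟩ := exists_isCycleLeader σ x
      exact ⟨⟨i, hi⟩, Quotient.sound hix⟩

theorem isCycleLeader_reverseCycle (σ : Perm (Fin n)) (b i : Fin n) :
    IsCycleLeader (reverseCycle σ b) i ↔ IsCycleLeader σ i := by
  simp only [IsCycleLeader, sameCycle_reverseCycle]

theorem pow_minimalPeriod_apply (σ : Perm (Fin n)) (i : Fin n) :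
    (σ ^ Function.minimalPeriod σ i) i = i := by
  have := Function.isPeriodicPt_minimalPeriod σ i
  rwa [Function.IsPeriodicPt, Function.IsFixedPt, Equiv.Perm.iterate_eq_pow] at this

theorem minimalPeriod_congr {σ τ : Perm (Fin n)} {i : Fin n}
    (h : ∀ t : ℕ, (σ ^ t) i = i ↔ (τ ^ t) i = i) :
    Function.minimalPeriod σ i = Function.minimalPeriod τ i := by
  rw [Function.minimalPeriod_eq_minimalPeriod_iff]
  intro t
  simp only [Function.IsPeriodicPt, Function.IsFixedPt, Equiv.Perm.iterate_eq_pow, h t]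

section

variable {A : Type*} [Ring A] (X : Matrix (Fin n) (Fin n) A)

theorem cycleProduct_reverseCycle_of_not_sameCycle {σ : Perm (Fin n)} {b i : Fin n}
    (h : ¬ σ.SameCycle b i) :
    cycleProduct X (reverseCycle σ b) i = cycleProduct X σ i := by
  have hpow : ∀ t : ℕ, (reverseCycle σ b ^ t) i = (σ ^ t) i := by
    intro t
    induction t with
    | zero => rfl
    | succ k ih =>
      rw [pow_succ', Perm.mul_apply, ih, pow_succ', Perm.mul_apply]
      exact reverseCycle_apply_of_not_sameCycle fun e => h (sameCycle_pow_right.1 e)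
  rw [cycleProduct, cycleProduct, minimalPeriod_congr (τ := σ) fun t => by rw [hpow]]
  simp only [hpow]

/-- The reversed cycle is read backwards from the same starting point, and self-duality stars each
factor. -/
theorem cycleProduct_reverseCycle_self [StarRing A] (hX : ∀ i j, X j i = star (X i j))
    (σ : Perm (Fin n)) (b : Fin n) :
    cycleProduct X (reverseCycle σ b) b = star (cycleProduct X σ b) := by
  have hpow : ∀ t : ℕ, (σ ^ t) ((reverseCycle σ b ^ t) b) = b := by
    intro t
    induction t with
    | zero => rfl
    | succ k ih =>
      have hs : σ.SameCycle b ((reverseCycle σ b ^ k) b) :=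
        (sameCycle_reverseCycle σ b _ _).1 (sameCycle_pow_right.2 (SameCycle.refl _ _))
      rw [pow_succ' (reverseCycle σ b), Perm.mul_apply, reverseCycle_apply_of_sameCycle hs,
        pow_succ, Perm.mul_apply]
      simpa using ih
  have hp : Function.minimalPeriod (reverseCycle σ b) b = Function.minimalPeriod σ b := by
    refine minimalPeriod_congr fun t => ?_
    constructor
    · intro h
      have := hpow t
      rwa [h] at this
    · intro h
      refine (σ ^ t).injective ?_
      rw [hpow, h]
  rw [cycleProduct, cycleProduct, hp, List.star_prod_map_range]
  congr 1
  refine List.map_congr_left fun t ht => ?_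
  rw [List.mem_range] at ht
  rw [← hX]
  have hrev : ∀ t ≤ Function.minimalPeriod σ b,
      (reverseCycle σ b ^ t) b = (σ ^ (Function.minimalPeriod σ b - t)) b := by
    intro t ht
    refine (σ ^ t).injective ?_
    rw [hpow, ← Perm.mul_apply, ← pow_add, Nat.add_sub_cancel' ht, pow_minimalPeriod_apply]
  rw [hrev t ht.le, hrev (t + 1) ht]
  congr 3 <;> omega

end

/-- The leaders are treated one at a time: those in `L₁` already carry real parts, and each
inductive step moves the head of `L₂` to the end of `L₁`, so the order of the noncommuting factors
is kept. -/
theorem sum_sign_prod_cycleProduct {X : Matrix (Fin n) (Fin n) ℍ[ℝ]}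
    (hX : ∀ i j, X j i = star (X i j)) (L₂ L₁ : List (Fin n)) (hL : (L₁ ++ L₂).Nodup) :
    ∑ σ : Perm (Fin n), ((sign σ : ℤˣ) : ℤ) •
      ((L₁.map fun i => if IsCycleLeader σ i then ((cycleProduct X σ i).re : ℍ[ℝ]) else 1).prod *
        (L₂.map fun i => if IsCycleLeader σ i then cycleProduct X σ i else 1).prod) =
    ∑ σ : Perm (Fin n), ((sign σ : ℤˣ) : ℤ) •
      ((L₁ ++ L₂).map fun i =>
        if IsCycleLeader σ i then ((cycleProduct X σ i).re : ℍ[ℝ]) else 1).prod := by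
  induction L₂ generalizing L₁ with
  | nil => simp
  | cons j L₂ ih =>
    have hL' : ((L₁ ++ [j]) ++ L₂).Nodup := by simpa using hL
    have hih := ih (L₁ ++ [j]) hL'
    rw [List.append_assoc, List.singleton_append] at hih
    rw [← hih]
    have hj₁ : ∀ i ∈ L₁, i ≠ j := by
      rintro i hi rfl
      exact (List.nodup_append.1 hL).2.2 i hi i (by simp) rfl
    have hj₂ : ∀ i ∈ L₂, i ≠ j := by
      rintro i hi rfl
      exact (List.nodup_cons.1 (List.nodup_append.1 hL).2.1).1 hi
    let φ : Perm (Fin n) → Perm (Fin n) := fun σ =>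
      if IsCycleLeader σ j then reverseCycle σ j else σ
    have hφl : ∀ σ i, IsCycleLeader (φ σ) i ↔ IsCycleLeader σ i := by
      intro σ i
      by_cases h : IsCycleLeader σ j
      · simp only [φ, if_pos h, isCycleLeader_reverseCycle]
      · simp only [φ, if_neg h]
    have hφ : Function.Involutive φ := by
      intro σ
      by_cases h : IsCycleLeader σ j
      · have h' : IsCycleLeader (reverseCycle σ j) j := (isCycleLeader_reverseCycle σ j j).2 h
        simp only [φ, if_pos h, if_pos h']
        exact reverseCycle_involutive j σ
      · simp only [φ, if_neg h]
    have hs : ∀ σ, sign (φ σ) = sign σ := by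
      intro σ
      by_cases h : IsCycleLeader σ j
      · simp only [φ, if_pos h, sign_reverseCycle]
      · simp only [φ, if_neg h]
    have hne : ∀ σ i, i ≠ j → IsCycleLeader σ i →
        cycleProduct X (φ σ) i = cycleProduct X σ i := by
      intro σ i hij hi
      by_cases h : IsCycleLeader σ j
      · simp only [φ, if_pos h]
        exact cycleProduct_reverseCycle_of_not_sameCycle X fun e => hij (h.eq hi e).symm
      · simp only [φ, if_neg h]
    have hself : ∀ σ, IsCycleLeader σ j → cycleProduct X (φ σ) j = star (cycleProduct X σ j) := by
      intro σ h
      simp only [φ, if_pos h]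
      exact cycleProduct_reverseCycle_self X hX σ j
    have h2 : (2 : ℍ[ℝ]) ≠ 0 := by
      intro h
      exact two_ne_zero' ℝ (congrArg QuaternionAlgebra.re h)
    refine mul_left_cancel₀ h2 ?_
    simp only [two_mul]
    -- One of the two copies is reindexed by reversing the cycle led by `j`; the factor at `j`
    -- becomes `q + star q = 2 Re q`, all others being unchanged.
    nth_rewrite 2 [← Equiv.sum_comp (hφ.toPerm φ)]
    rw [← Finset.sum_add_distrib, ← Finset.sum_add_distrib]
    refine Finset.sum_congr rfl fun σ _ => ?_
    simp only [Function.Involutive.coe_toPerm, hs, ← smul_add, hφl]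
    congr 1
    have e₁ : (L₁.map fun i =>
        if IsCycleLeader σ i then ((cycleProduct X (φ σ) i).re : ℍ[ℝ]) else 1) =
        L₁.map fun i => if IsCycleLeader σ i then ((cycleProduct X σ i).re : ℍ[ℝ]) else 1 := by
      refine List.map_congr_left fun i hi => ?_
      split_ifs with h
      · rw [hne σ i (hj₁ i hi) h]
      · rfl
    have e₂ : (L₂.map fun i => if IsCycleLeader σ i then cycleProduct X (φ σ) i else 1) =
        L₂.map fun i => if IsCycleLeader σ i then cycleProduct X σ i else 1 := by
      refine List.map_congr_left fun i hi => ?_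
      split_ifs with h
      · rw [hne σ i (hj₂ i hi) h]
      · rfl
    simp only [List.map_cons, List.prod_cons, List.map_append, List.prod_append, List.map_nil,
      List.prod_nil, mul_one, e₁, e₂]
    by_cases h : IsCycleLeader σ j
    · simp only [if_pos h, hself σ h]
      rw [← mul_add, ← add_mul, Quaternion.self_add_star]
      noncomm_ring
    · simp only [if_neg h]
      noncomm_ring

theorem mooreDysonDet_eq_sum_re {X : Matrix (Fin n) (Fin n) ℍ[ℝ]}
    (hX : ∀ i j, X j i = star (X i j)) :
    mooreDysonDet X = algebraMap ℝ ℍ[ℝ] (∑ σ : Perm (Fin n), ((sign σ : ℤ) : ℝ) *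
      ∏ i, if IsCycleLeader σ i then (cycleProduct X σ i).re else 1) := by
  have h := sum_sign_prod_cycleProduct hX (List.finRange n).reverse []
    (by simpa using List.nodup_finRange n)
  simp only [List.map_nil, List.prod_nil, one_mul, List.nil_append] at h
  rw [mooreDysonDet]
  simp only [cycleLeaders]
  rw [Finset.sum_congr rfl fun σ _ => by
    rw [List.prod_map_filter_eq_ite _ (fun i => ∀ j, σ.SameCycle i j → j ≤ i)]]
  refine h.trans ?_
  rw [map_sum]
  refine Finset.sum_congr rfl fun σ _ => ?_
  rw [map_mul, map_intCast, zsmul_eq_mul, Fin.prod_univ_def,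
    ← ((List.reverse_perm (List.finRange n)).map _).prod_eq, map_list_prod, List.map_map]
  congr 3
  funext i
  simp only [Function.comp_apply]
  split_ifs <;> simp

theorem Matrix.list_prod_map_range_apply (k : ℕ) (M : ℕ → Matrix Bool Bool ℂ) (a b : Bool) :
    ((List.range (k + 1)).map M).prod a b = ∑ c : Fin k → Bool,
      ∏ t : Fin (k + 1), M t (Fin.cons (α := fun _ => Bool) a c t)
        (Fin.snoc (α := fun _ => Bool) c b t) := by
  induction k generalizing M a with
  | zero => simp [Fin.snoc]
  | succ k ih =>
    rw [List.range_succ_eq_map, List.map_cons, List.prod_cons, List.map_map, Matrix.mul_apply,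
      ← Equiv.sum_comp (Fin.consEquiv fun _ => Bool), Fintype.sum_prod_type]
    refine Finset.sum_congr rfl fun d _ => ?_
    rw [ih, Finset.mul_sum]
    refine Finset.sum_congr rfl fun c _ => ?_
    rw [Fin.prod_univ_succ (n := k + 1)]
    simp only [Fin.consEquiv, Equiv.coe_fn_mk, Fin.cons_zero, Fin.cons_succ,
      ← Fin.cons_snoc_eq_snoc_cons]
    simp

/-- Addition in `Fin p` is cyclic, so the last factor returns to colour `s 0` and closes the path.
-/
theorem Matrix.trace_list_prod_map_range (p : ℕ) [NeZero p] (M : ℕ → Matrix Bool Bool ℂ) :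
    ((List.range p).map M).prod.trace =
      ∑ s : Fin p → Bool, ∏ t : Fin p, M t (s t) (s (t + 1)) := by
  obtain ⟨k, rfl⟩ := Nat.exists_eq_succ_of_ne_zero (NeZero.ne p)
  rw [← Equiv.sum_comp (Fin.consEquiv fun _ => Bool), Fintype.sum_prod_type, Matrix.trace]
  refine Finset.sum_congr rfl fun a _ => ?_
  rw [Matrix.diag_apply, Matrix.list_prod_map_range_apply]
  refine Finset.sum_congr rfl fun c _ => Finset.prod_congr rfl fun t _ => ?_
  simp only [Fin.consEquiv, Equiv.coe_fn_mk]
  congr 1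
  induction t using Fin.lastCases with
  | last => simp
  | cast t => simp [Fin.coeSucc_eq_succ]

/-- The elements are parametrized by their cycle leaders and their positions in the cycles. -/
noncomputable def cycleLeaderEquiv (σ : Perm (Fin n)) :
    (Σ i : {i // IsCycleLeader σ i}, Fin (Function.minimalPeriod σ i.1)) ≃ Fin n :=
  Equiv.ofBijective (fun z => (σ ^ (z.2 : ℕ)) z.1.1) (by
    constructor
    · rintro ⟨⟨i, hi⟩, t⟩ ⟨⟨j, hj⟩, t'⟩ h
      have hij : i = j := hi.eq hj (SameCycle.trans ⟨(t : ℕ), by simpa using h⟩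
        (SameCycle.symm ⟨(t' : ℕ), by simp⟩))
      subst hij
      have := Function.iterate_injOn_Iio_minimalPeriod (f := σ) (x := i) t.2 t'.2
        (by simpa [Equiv.Perm.iterate_eq_pow] using h)
      congr 1
      exact Fin.ext this
    · intro x
      obtain ⟨i, hi, hix⟩ := exists_isCycleLeader σ x
      obtain ⟨t, -, rfl⟩ := hix.exists_pow_eq'
      have hpos : 0 < Function.minimalPeriod σ i :=
        Function.IsPeriodicPt.minimalPeriod_pos (orderOf_pos σ) (by
          rw [Function.IsPeriodicPt, Function.IsFixedPt, Equiv.Perm.iterate_eq_pow,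
            pow_orderOf_eq_one]
          rfl)
      refine ⟨⟨⟨i, hi⟩, ⟨t % Function.minimalPeriod σ i, Nat.mod_lt _ hpos⟩⟩, ?_⟩
      have := Function.iterate_mod_minimalPeriod_eq (f := σ) (x := i) (n := t)
      simp only [Equiv.Perm.iterate_eq_pow] at this
      exact this)

instance (σ : Perm (Fin n)) (i : Fin n) : NeZero (Function.minimalPeriod σ i) :=
  ⟨(Function.IsPeriodicPt.minimalPeriod_pos (orderOf_pos σ) (by
    rw [Function.IsPeriodicPt, Function.IsFixedPt, Equiv.Perm.iterate_eq_pow,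
      pow_orderOf_eq_one]
    rfl)).ne'⟩

theorem cycleLeaderEquiv_apply (σ : Perm (Fin n))
    (z : Σ i : {i // IsCycleLeader σ i}, Fin (Function.minimalPeriod σ i.1)) :
    cycleLeaderEquiv σ z = (σ ^ (z.2 : ℕ)) z.1.1 := rfl

theorem apply_cycleLeaderEquiv (σ : Perm (Fin n)) (i : {i // IsCycleLeader σ i})
    (t : Fin (Function.minimalPeriod σ i.1)) :
    σ (cycleLeaderEquiv σ ⟨i, t⟩) = cycleLeaderEquiv σ ⟨i, t + 1⟩ := by
  rw [cycleLeaderEquiv_apply, cycleLeaderEquiv_apply, ← Perm.mul_apply, ← pow_succ']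
  have := Function.iterate_mod_minimalPeriod_eq (f := σ) (x := i.1) (n := (t : ℕ) + 1)
  simp only [Equiv.Perm.iterate_eq_pow] at this
  rw [← this]
  congr 2
  rw [Fin.val_add, Fin.val_one']
  simp

/-- A colouring of all elements is an independent choice of colouring on each cycle, so the sum
factors into traces. -/
theorem colorSum_eq_prod_trace (X : Matrix (Fin n) (Fin n) ℍ[ℝ]) (σ : Perm (Fin n)) :
    colorSum (fun i j => quaternionMatrix (X i j)) σ =
      ∏ i : {i // IsCycleLeader σ i}, (quaternionMatrix (cycleProduct X σ i)).trace := by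
  have h : ∀ i : {i // IsCycleLeader σ i}, (quaternionMatrix (cycleProduct X σ i)).trace =
      ∑ s : Fin (Function.minimalPeriod σ i.1) → Bool, ∏ t,
        quaternionMatrix (X (cycleLeaderEquiv σ ⟨i, t⟩) (σ (cycleLeaderEquiv σ ⟨i, t⟩)))
          (s t) (s (t + 1)) := by
    intro i
    rw [cycleProduct, map_list_prod, List.map_map, Matrix.trace_list_prod_map_range]
    simp only [cycleLeaderEquiv_apply, Function.comp_apply, pow_succ', Perm.mul_apply]
  rw [Finset.prod_congr rfl fun i _ => h i, Finset.prod_univ_sum, Fintype.piFinset_univ, colorSum,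
    ← Equiv.sum_comp (((cycleLeaderEquiv σ).arrowCongr (Equiv.refl Bool)).symm.trans
      (Equiv.piCurry fun _ _ => Bool))]
  refine Finset.sum_congr rfl fun s _ => ?_
  rw [colorProd, ← Equiv.prod_comp (cycleLeaderEquiv σ), Fintype.prod_sigma]
  refine Finset.prod_congr rfl fun i _ => Finset.prod_congr rfl fun t _ => ?_
  rw [apply_cycleLeaderEquiv]
  rfl

/-- The real part of a quaternion is half the trace of its block, which accounts for the factor `1 /
2` per cycle in `cycleWeight`. -/
theorem mooreDysonDet_eq_symplecticDet {X : Matrix (Fin n) (Fin n) ℍ[ℝ]}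
    (hX : ∀ i j, X j i = star (X i j)) :
    mooreDysonDet X =
      algebraMap ℝ ℍ[ℝ] (symplecticDet fun i j => quaternionMatrix (X i j)).re := by
  rw [mooreDysonDet_eq_sum_re hX]
  congr 1
  rw [← Complex.ofReal_re (∑ σ : Perm (Fin n), _)]
  congr 1
  rw [Complex.ofReal_sum, symplecticDet]
  refine Finset.sum_congr rfl fun σ _ => ?_
  rw [cycleWeight, colorSum_eq_prod_trace, cycleCount_eq_card_isCycleLeader, mul_assoc,
    ← Finset.card_univ, ← Finset.prod_const, ← Finset.prod_mul_distrib, Complex.ofReal_mul,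
    ← Finset.prod_filter, Complex.ofReal_prod]
  congr 1
  rw [Finset.prod_subtype (p := IsCycleLeader σ) _ (by simp)]
  refine Finset.prod_congr rfl fun i _ => ?_
  rw [trace_quaternionMatrix]
  ring

end MooreDyson

/-! ### Determinants of kernels with a diagonal form -/

section KernelDet

open Equiv Equiv.Perm

variable {V ι Λ : Type*} [Fintype V] [DecidableEq V]

/-- The real part of the Moore determinant of a quaternion matrix. -/
noncomputable def mooreReal (X : V → V → ℍ[ℝ]) : ℝ :=
  (symplecticDet fun i j => quaternionMatrix (X i j)).re

/-- The entry of the matrix of a quaternion, as a continuous linear map. -/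
noncomputable def quaternionEntry (p r : Bool) : ℍ[ℝ] →L[ℝ] ℂ :=
  LinearMap.toContinuousLinearMap
    ((Matrix.entryLinearMap ℝ ℂ p r).comp quaternionMatrix.toLinearMap)

/-- The real part of a quaternion, as a continuous linear map. -/
noncomputable def quaternionRe : ℍ[ℝ] →L[ℝ] ℝ :=
  LinearMap.toContinuousLinearMap
    { toFun := fun q => q.re, map_add' := fun _ _ => rfl, map_smul' := fun _ _ => rfl }

theorem continuous_mooreReal : Continuous (mooreReal : (V → V → ℍ[ℝ]) → ℝ) := by
  refine Complex.continuous_re.comp (?_ : Continuous fun X : V → V → ℍ[ℝ] =>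
    symplecticDet fun i j => quaternionMatrix (X i j))
  refine continuous_finsetSum _ fun σ _ => continuous_const.mul ?_
  refine continuous_finsetSum _ fun s _ => continuous_finsetProd _ fun i _ => ?_
  exact (quaternionEntry (s i) (s (σ i))).continuous.comp (by fun_prop)

theorem gramDet_eq_mooreReal {κ : Type*} [Fintype κ] (w : V → κ → ℍ[ℝ]) :
    gramDet w = mooreReal fun i j => ∑ c, star (w i c) * w j c := rfl

/-- Cauchy–Binet, with the points and the indices exchanged. For `l ≥ 0` every term on the right is
nonnegative, which makes the passage to infinite sums monotone. -/
theorem factorial_mul_mooreReal (l : ι → ℝ) (u : ι → Λ → ℍ[ℝ]) (F : Finset ι) (x : V → Λ) :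
    (Fintype.card V).factorial *
        mooreReal (fun i j => ∑ k ∈ F, l k • (u k (x i) * star (u k (x j)))) =
      ∑ k ∈ Fintype.piFinset fun _ : V => F, (∏ i, l (k i)) *
        gramDet fun i v => u (k i) (x v) := by
  classical
  have h1 := sum_symplecticDet_comp (W := V) F (fun k => (l k : ℂ))
    (fun i k => quaternionMatrix (u k (x i))) (fun k j => quaternionMatrix (star (u k (x j))))
  have h2 : ∀ i j, ∑ k ∈ F, (l k : ℂ) •
      (quaternionMatrix (u k (x i)) * quaternionMatrix (star (u k (x j)))) =
      quaternionMatrix (∑ k ∈ F, l k • (u k (x i) * star (u k (x j)))) := by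
    intro i j
    rw [map_sum]
    refine Finset.sum_congr rfl fun k _ => ?_
    rw [map_smul, map_mul]
    ext p r
    simp
  have h3 : ∀ (k : V → ι) i j, ∑ v, quaternionMatrix (star (u (k i) (x v))) *
      quaternionMatrix (u (k j) (x v)) = crossGram (fun i v => u (k i) (x v))
        (fun i v => u (k i) (x v)) i j := by
    intro k i j
    simp [crossGram]
  simp only [h2, h3] at h1
  rw [sum_symplecticDet_comp_self (Y := fun i j =>
    quaternionMatrix (∑ k ∈ F, l k • (u k (x i) * star (u k (x j)))))] at h1
  · have h4 := congrArg Complex.re h1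
    simp only [← coe_gramDet] at h4
    have h5 : ∀ z : ℂ, (((Fintype.card V).factorial : ℂ) * z).re =
        (Fintype.card V).factorial * z.re := by
      intro z
      rw [← Complex.ofReal_natCast, Complex.re_ofReal_mul]
    rw [h5] at h4
    rw [mooreReal, h4, Complex.re_sum]
    refine Finset.sum_congr rfl fun k _ => ?_
    rw [← Complex.ofReal_prod, Complex.re_ofReal_mul, Complex.ofReal_re]
  · intro i j p q
    rw [← quaternionMatrix_star, star_sum]
    simp

theorem tsum_ofReal_gramDet {l : ι → ℝ} (hl : ∀ k, 0 ≤ l k) {u : ι → Λ → ℍ[ℝ]} {x : V → Λ}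
    (hs : ∀ i j, Summable fun k => ‖l k • (u k (x i) * star (u k (x j)))‖) :
    ∑' k : V → ι, ENNReal.ofReal ((∏ i, l (k i)) * gramDet fun i v => u (k i) (x v)) =
      (Fintype.card V).factorial * ENNReal.ofReal
        (mooreReal fun i j => ∑' k, l k • (u k (x i) * star (u k (x j)))) := by
  classical
  have hnn : ∀ k : V → ι, 0 ≤ (∏ i, l (k i)) * gramDet fun i v => u (k i) (x v) := fun k =>
    mul_nonneg (Finset.prod_nonneg fun i _ => hl _) (gramDet_nonneg _)
  rw [ENNReal.tsum_eq_iSup_sum' fun F : Finset ι => Fintype.piFinset fun _ : V => F]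
  · have hmono : Monotone fun F : Finset ι => ∑ k ∈ Fintype.piFinset fun _ : V => F,
        ENNReal.ofReal ((∏ i, l (k i)) * gramDet fun i v => u (k i) (x v)) := fun F F' h =>
      Finset.sum_le_sum_of_subset (Fintype.piFinset_subset _ _ fun _ => h)
    -- The same partial sums converge to the supremum by monotonicity and to the other side by
    -- continuity of the determinant in its entries.
    refine tendsto_nhds_unique (tendsto_atTop_iSup hmono) ?_
    have hlim : Filter.Tendsto (fun F : Finset ι => ((Fintype.card V).factorial : ℝ) *
        mooreReal (fun i j => ∑ k ∈ F, l k • (u k (x i) * star (u k (x j))))) Filter.atTop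
        (nhds ((Fintype.card V).factorial *
          mooreReal fun i j => ∑' k, l k • (u k (x i) * star (u k (x j))))) := by
      refine Filter.Tendsto.const_mul _ ((continuous_mooreReal.tendsto _).comp ?_)
      rw [tendsto_pi_nhds]
      intro i
      rw [tendsto_pi_nhds]
      intro j
      exact (hs i j).of_norm.hasSum
    have := (ENNReal.continuous_ofReal.tendsto _).comp hlim
    rw [ENNReal.ofReal_mul (by positivity), ENNReal.ofReal_natCast] at this
    refine this.congr fun F => ?_
    rw [Function.comp_apply, factorial_mul_mooreReal, ENNReal.ofReal_sum_of_nonneg]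
    exact fun k _ => hnn k
  · intro t
    refine ⟨t.biUnion fun k => Finset.univ.image k, fun k hk => ?_⟩
    rw [Fintype.mem_piFinset]
    intro i
    rw [Finset.mem_biUnion]
    exact ⟨k, hk, Finset.mem_image_of_mem _ (Finset.mem_univ i)⟩

/-- The determinant of the projection kernel `∑_{k ∈ I} u_k(x) u_k(y)^*`. -/
noncomputable def projectionDet (u : ι → Λ → ℍ[ℝ]) (I : Finset ι) (x : V → Λ) : ℝ :=
  mooreReal fun i j => ∑ k ∈ I, u k (x i) * star (u k (x j))

/-- The projection kernel is the Gram matrix of the vectors `(star (u k (x i)))` indexed by `k ∈ I`;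
this gives its sign and its vanishing at repeated points. -/
theorem projectionDet_eq_gramDet (u : ι → Λ → ℍ[ℝ]) (I : Finset ι) (x : V → Λ) :
    projectionDet u I x = gramDet fun i (k : I) => star (u k (x i)) := by
  rw [gramDet_eq_mooreReal, projectionDet]
  simp only [star_star]
  congr 1
  funext i j
  exact (Finset.sum_coe_sort I fun k => u k (x i) * star (u k (x j))).symm

theorem projectionDet_nonneg (u : ι → Λ → ℍ[ℝ]) (I : Finset ι) (x : V → Λ) :
    0 ≤ projectionDet u I x := by
  rw [projectionDet_eq_gramDet]
  exact gramDet_nonneg _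

theorem injective_of_projectionDet_ne_zero {u : ι → Λ → ℍ[ℝ]} {I : Finset ι} {x : V → Λ}
    (h : projectionDet u I x ≠ 0) : Function.Injective x := by
  intro i j hij
  by_contra hne
  refine h ?_
  rw [projectionDet_eq_gramDet]
  refine gramDet_of_eq hne ?_
  simp only [hij]

theorem projectionDet_reindex {W : Type*} [Fintype W] [DecidableEq W] (e : W ≃ V)
    (u : ι → Λ → ℍ[ℝ]) (I : Finset ι) (x : V → Λ) :
    projectionDet u I (fun i => x (e i)) = projectionDet u I x := by
  rw [projectionDet_eq_gramDet, projectionDet_eq_gramDet]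
  exact gramDet_reindex e fun i (k : I) => star (u k (x i))

theorem factorial_mul_projectionDet (u : ι → Λ → ℍ[ℝ]) (I : Finset ι) (x : V → Λ) :
    (Fintype.card V).factorial * projectionDet u I x =
      ∑ k ∈ Fintype.piFinset fun _ : V => I, gramDet fun i v => u (k i) (x v) := by
  simpa [projectionDet] using factorial_mul_mooreReal (fun _ => 1) u I x

theorem measurable_mooreReal {α : Type*} [MeasurableSpace α] {X : α → V → V → ℍ[ℝ]}
    (hX : ∀ i j, StronglyMeasurable fun a => X a i j) :
    Measurable fun a => mooreReal (X a) := by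
  borelize ℍ[ℝ]
  exact continuous_mooreReal.measurable.comp
    (measurable_pi_lambda _ fun i => measurable_pi_lambda _ fun j => (hX i j).measurable)

theorem measurable_projectionDet [MeasurableSpace Λ] {u : ι → Λ → ℍ[ℝ]}
    (hu : ∀ k, StronglyMeasurable (u k)) (I : Finset ι) :
    Measurable fun x : V → Λ => projectionDet u I x := by
  refine measurable_mooreReal fun i j => Finset.stronglyMeasurable_fun_sum _ fun k _ => ?_
  exact ((hu k).comp_measurable (measurable_pi_apply i)).mul
    ((hu k).comp_measurable (measurable_pi_apply j)).star

/-! ### Integrating out a point of a projection determinant. -/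

section Integration

variable [MeasurableSpace Λ] {μ : Measure Λ} {u : ι → Λ → ℍ[ℝ]}

/-- Orthonormality of a family of square-integrable quaternion functions. -/
structure QuaternionOrthonormal (μ : Measure Λ) (u : ι → Λ → ℍ[ℝ]) : Prop where
  memLp : ∀ k, MemLp (u k) 2 μ
  integral_eq_one : ∀ k, ∫ x, star (u k x) * u k x ∂μ = 1
  integral_eq_zero : ∀ k k', k ≠ k' → ∫ x, star (u k x) * u k' x ∂μ = 0

theorem QuaternionOrthonormal.integrable (hu : QuaternionOrthonormal μ u) (k k' : ι) :
    Integrable (fun x => star (u k x) * u k' x) μ :=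
  (hu.memLp k).star.integrable_mul (hu.memLp k')

/-- By orthonormality only the diagonal terms of the double sum survive: the kernel is idempotent.
-/
theorem QuaternionOrthonormal.integrable_reproducing (hu : QuaternionOrthonormal μ u)
    (I : Finset ι) (a b : Λ) :
    Integrable (fun y => (∑ k ∈ I, u k a * star (u k y)) * ∑ k ∈ I, u k y * star (u k b)) μ ∧
    ∫ y, (∑ k ∈ I, u k a * star (u k y)) * ∑ k ∈ I, u k y * star (u k b) ∂μ =
      ∑ k ∈ I, u k a * star (u k b) := by
  have h : ∀ y, (∑ k ∈ I, u k a * star (u k y)) * ∑ k ∈ I, u k y * star (u k b) =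
      ∑ k ∈ I, ∑ k' ∈ I, u k a * (star (u k y) * u k' y) * star (u k' b) := by
    intro y
    rw [Finset.sum_mul_sum]
    simp only [mul_assoc]
  have hi : ∀ k k', Integrable (fun y => u k a * (star (u k y) * u k' y) * star (u k' b)) μ :=
    fun k k' => ((hu.integrable k k').const_mul _).mul_const _
  simp only [h]
  refine ⟨integrable_finsetSum _ fun k _ => integrable_finsetSum _ fun k' _ => hi k k', ?_⟩
  rw [integral_finsetSum _ fun k _ => integrable_finsetSum _ fun k' _ => hi k k']
  refine Finset.sum_congr rfl fun k hk => ?_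
  rw [integral_finsetSum _ fun k' _ => hi k k', Finset.sum_eq_single k]
  · rw [integral_mul_const_of_integrable ((hu.integrable _ _).const_mul _),
      integral_const_mul_of_integrable (hu.integrable _ _), hu.integral_eq_one, mul_one]
  · intro k' _ hne
    rw [integral_mul_const_of_integrable ((hu.integrable _ _).const_mul _),
      integral_const_mul_of_integrable (hu.integrable _ _), hu.integral_eq_zero k k' hne.symm, mul_zero,
      zero_mul]
  · exact fun h => absurd hk h

theorem QuaternionOrthonormal.integrable_trace (hu : QuaternionOrthonormal μ u)
    (I : Finset ι) :
    Integrable (fun y => quaternionRe (∑ k ∈ I, u k y * star (u k y))) μ ∧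
    ∫ y, quaternionRe (∑ k ∈ I, u k y * star (u k y)) ∂μ = I.card := by
  have h : ∀ y, quaternionRe (∑ k ∈ I, u k y * star (u k y)) =
      ∑ k ∈ I, quaternionRe (star (u k y) * u k y) := by
    intro y
    rw [map_sum]
    simp only [Quaternion.self_mul_star, Quaternion.star_mul_self]
  have hc : ∀ k, Integrable (fun y => quaternionRe (star (u k y) * u k y)) μ ∧
      ∫ y, quaternionRe (star (u k y) * u k y) ∂μ = 1 := by
    intro k
    refine ⟨quaternionRe.integrable_comp (hu.integrable k k), ?_⟩
    rw [quaternionRe.integral_comp_comm (hu.integrable k k), hu.integral_eq_one]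
    rfl
  simp only [h]
  refine ⟨integrable_finsetSum _ fun k _ => (hc k).1, ?_⟩
  rw [integral_finsetSum _ fun k _ => (hc k).1, Finset.sum_congr rfl fun k _ => (hc k).2]
  simp

/-- Integrating out one variable in the determinant of a projection kernel. -/
theorem QuaternionOrthonormal.lintegral_projectionDet_option (hu : QuaternionOrthonormal μ u)
    (I : Finset ι) (x : V → Λ) :
    ∫⁻ y, ENNReal.ofReal (projectionDet u I fun o : Option V => o.elim y x) ∂μ =
      ENNReal.ofReal ((I.card - Fintype.card V) * projectionDet u I x) := by
  set Y : V → V → Matrix Bool Bool ℂ := fun i j =>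
    quaternionMatrix (∑ k ∈ I, u k (x i) * star (u k (x j))) with hY
  let P : Perm V → V → (V → Bool) → ℂ := fun π a s =>
    ∏ i ∈ Finset.univ.erase a, Y i (π i) (s i) (s (π i))
  let E : Λ → V → V → ℍ[ℝ] := fun y a b =>
    (∑ k ∈ I, u k (x a) * star (u k y)) * ∑ k ∈ I, u k y * star (u k (x b))
  have hE : ∀ a b p r, Integrable (fun y => quaternionEntry p r (E y a b)) μ ∧
      ∫ y, quaternionEntry p r (E y a b) ∂μ = Y a b p r := by
    intro a b p r
    obtain ⟨h1, h2⟩ := hu.integrable_reproducing I (x a) (x b)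
    refine ⟨(quaternionEntry p r).integrable_comp h1, ?_⟩
    rw [(quaternionEntry p r).integral_comp_comm h1, h2]
    rfl
  obtain ⟨ht1, ht2⟩ := hu.integrable_trace I
  let f : Λ → ℂ := fun y => (quaternionRe (∑ k ∈ I, u k y * star (u k y)) : ℂ) * symplecticDet Y -
    ∑ π : Perm V, cycleWeight π * ∑ a, ∑ s : V → Bool,
      P π a s * quaternionEntry (s a) (s (π a)) (E y a (π a))
  have hf : ∀ y, projectionDet u I (fun o : Option V => o.elim y x) = (f y).re := by
    intro y
    rw [projectionDet, mooreReal, symplecticDet_option]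
    simp only [Option.elim_none, Option.elim_some, trace_quaternionMatrix, ← map_mul]
    rw [← mul_assoc, one_div, inv_mul_cancel₀ (two_ne_zero' ℂ), one_mul]
    rfl
  have hi1 : Integrable (fun y => (quaternionRe (∑ k ∈ I, u k y * star (u k y)) : ℂ) * symplecticDet Y) μ :=
    ht1.ofReal.mul_const _
  have hi2 : ∀ π : Perm V, Integrable (fun y => cycleWeight π * ∑ a, ∑ s : V → Bool,
      P π a s * quaternionEntry (s a) (s (π a)) (E y a (π a))) μ := fun π =>
    (integrable_finsetSum _ fun a _ => integrable_finsetSum _ fun s _ =>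
      (hE _ _ _ _).1.const_mul _).const_mul _
  have hfi : Integrable f μ := hi1.sub (integrable_finsetSum _ fun π _ => hi2 π)
  have hint : ∫ y, f y ∂μ = ((I.card : ℂ) - Fintype.card V) * symplecticDet Y := by
    rw [integral_sub hi1 (integrable_finsetSum _ fun π _ => hi2 π), integral_mul_const,
      integral_complex_ofReal, ht2, integral_finsetSum _ fun π _ => hi2 π, sub_mul]
    congr 1
    rw [symplecticDet, Finset.mul_sum]
    refine Finset.sum_congr rfl fun π _ => ?_
    rw [integral_const_mul, integral_finsetSum _ fun a _ => integrable_finsetSum _ fun s _ =>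
      (hE _ _ _ _).1.const_mul _, mul_left_comm]
    congr 1
    -- By the reproducing property, each of the `card V` places where `y` can be inserted in a cycle
    -- of `π` integrates to the same term; hence the `-card V`.
    rw [Fintype.card, ← nsmul_eq_mul, ← Finset.sum_const]
    refine Finset.sum_congr rfl fun a _ => ?_
    rw [integral_finsetSum _ fun s _ => (hE _ _ _ _).1.const_mul _, colorSum]
    refine Finset.sum_congr rfl fun s _ => ?_
    rw [integral_const_mul, (hE _ _ _ _).2, colorProd,
      ← Finset.mul_prod_erase _ _ (Finset.mem_univ a), mul_comm]
  simp only [hf]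
  have hre := Complex.reCLM.integral_comp_comm hfi
  simp only [Complex.reCLM_apply] at hre
  have hire : Integrable (fun y => (f y).re) μ := Complex.reCLM.integrable_comp hfi
  rw [← ofReal_integral_eq_lintegral_ofReal hire]
  swap
  · refine Filter.Eventually.of_forall fun y => ?_
    have := projectionDet_nonneg u I fun o : Option V => o.elim y x
    rwa [hf y] at this
  congr 1
  refine hre.trans ?_
  rw [hint, projectionDet, mooreReal]
  have : ((I.card : ℂ) - Fintype.card V) = ((I.card - Fintype.card V : ℝ) : ℂ) := by push_cast; rfl
  rw [this]
  exact Complex.re_ofReal_mul _ _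

end Integration

end KernelDet

/-! ### Marginals of the determinants of projection kernels -/

section Marginals

theorem lintegral_pi_fin_zero {Λ : Type*} [MeasurableSpace Λ] {μ : Measure Λ}
    (f : (Fin 0 → Λ) → ℝ≥0∞) :
    ∫⁻ x, f x ∂(Measure.pi fun _ => μ) = f Fin.elim0 := by
  rw [Measure.pi_of_empty _ Fin.elim0, lintegral_dirac]

/-- By pigeonhole every index tuple repeats, so each Gram determinant in the Cauchy–Binet sum is
zero. -/
theorem projectionDet_eq_zero_of_card_lt {V : Type*} [Fintype V] [DecidableEq V]
    {ι Λ : Type*} (u : ι → Λ → ℍ[ℝ]) {I : Finset ι} (h : I.card < Fintype.card V) (x : V → Λ) : projectionDet u I x = 0 := by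
  have h1 := factorial_mul_projectionDet u I x
  rw [Finset.sum_eq_zero, mul_eq_zero] at h1
  · exact h1.resolve_left (by positivity)
  · intro k hk
    rw [Fintype.mem_piFinset] at hk
    have : ¬ Function.Injective k := by
      intro hinj
      have := Finset.card_le_card_of_injOn (s := Finset.univ) (t := I) k (fun i _ => hk i)
        hinj.injOn
      rw [Finset.card_univ] at this
      omega
    simp only [Function.Injective, not_forall] at this
    obtain ⟨a, b, hab, hne⟩ := this
    exact gramDet_of_eq hne (by simp only [hab])

variable {ι Λ : Type*} [MeasurableSpace Λ] {μ : Measure Λ} [SigmaFinite μ] {u : ι → Λ → ℍ[ℝ]}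

theorem lintegral_pi_comp_equiv {n : ℕ} (e : Fin n ≃ Fin n) {f : (Fin n → Λ) → ℝ≥0∞}
    (hf : Measurable f) :
    ∫⁻ x, f (fun i => x (e i)) ∂(Measure.pi fun _ => μ) = ∫⁻ x, f x ∂(Measure.pi fun _ => μ) :=
  (measurePreserving_arrowCongr' (fun _ : Fin n => μ) (fun _ : Fin n => μ) e.symm
    (MeasurableEquiv.refl Λ) fun _ => MeasurePreserving.id μ).lintegral_comp hf

theorem QuaternionOrthonormal.lintegral_comp_succAbove (hu : QuaternionOrthonormal μ u)
    (hm : ∀ k, StronglyMeasurable (u k)) (I : Finset ι) {n : ℕ} (hn : n < I.card)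
    (v : Fin (n + 1)) {f : (Fin n → Λ) → ℝ≥0∞} (hf : Measurable f) :
    ∫⁻ x, f (fun i => x (v.succAbove i)) * ENNReal.ofReal (projectionDet u I x)
        ∂(Measure.pi fun _ => μ) =
      (I.card - n : ℕ) * ∫⁻ x, f x * ENNReal.ofReal (projectionDet u I x)
        ∂(Measure.pi fun _ => μ) := by
  have hpd : ∀ {k : ℕ}, Measurable fun x : Fin k → Λ => ENNReal.ofReal (projectionDet u I x) :=
    fun {k} => (measurable_projectionDet hm I).ennreal_ofReal
  have hmeas : Measurable fun x : Fin (n + 1) → Λ =>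
      f (fun i => x (v.succAbove i)) * ENNReal.ofReal (projectionDet u I x) :=
    (hf.comp (measurable_pi_lambda _ fun i => measurable_pi_apply _)).mul hpd
  have hfp : Measurable fun x : Fin n → Λ => f x * ENNReal.ofReal (projectionDet u I x) :=
    hf.mul hpd
  have hmp := measurePreserving_piFinSuccAbove (fun _ : Fin (n + 1) => μ) v
  rw [← (hmp.symm _).lintegral_comp hmeas, lintegral_prod_symm]
  · rw [← lintegral_const_mul _ hfp]
    refine lintegral_congr fun x => ?_
    have h1 : ∀ y : Λ, ∀ i, (MeasurableEquiv.piFinSuccAbove (fun _ : Fin (n + 1) => Λ) v).symm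
        (y, x) (v.succAbove i) = x i := by
      intro y i
      exact Fin.insertNth_apply_succAbove (α := fun _ => Λ) v y x i
    have h2 : ∀ y : Λ, projectionDet u I
        ((MeasurableEquiv.piFinSuccAbove (fun _ : Fin (n + 1) => Λ) v).symm (y, x)) =
          projectionDet u I fun o : Option (Fin n) => o.elim y x := by
      intro y
      rw [← projectionDet_reindex (finSuccEquiv' v).symm]
      congr 1
      funext o
      cases o with
      | none => simp
      | some i => simp [h1]
    simp only [h1, h2]
    have hmo : Measurable fun y : Λ => ENNReal.ofReal
        (projectionDet u I fun o : Option (Fin n) => o.elim y x) := by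
      refine ((measurable_projectionDet hm I).comp ?_).ennreal_ofReal
      refine measurable_pi_lambda _ fun o => ?_
      cases o
      · exact measurable_id
      · exact measurable_const
    rw [lintegral_const_mul _ hmo, hu.lintegral_projectionDet_option, Fintype.card_fin,
      ← Nat.cast_sub hn.le, ENNReal.ofReal_mul (by positivity), ENNReal.ofReal_natCast]
    ring
  · exact (hmeas.comp (MeasurableEquiv.measurable _)).aemeasurable

/-- Points outside the range of `e` are integrated out one at a time; the factors multiply to `(N -
m)! / (N - n)!`, with `N` the size of `I`. A surjective `e` is a mere reindexing. -/
theorem QuaternionOrthonormal.lintegral_comp_embedding (hu : QuaternionOrthonormal μ u)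
    (hm : ∀ k, StronglyMeasurable (u k)) (I : Finset ι) {m n : ℕ} (hn : n ≤ I.card)
    (e : Fin m ↪ Fin n) {f : (Fin m → Λ) → ℝ≥0∞} (hf : Measurable f) :
    (I.card - n).factorial * ∫⁻ x, f (fun i => x (e i)) * ENNReal.ofReal (projectionDet u I x)
        ∂(Measure.pi fun _ => μ) =
      (I.card - m).factorial * ∫⁻ x, f x * ENNReal.ofReal (projectionDet u I x)
        ∂(Measure.pi fun _ => μ) := by
  induction n with
  | zero =>
    obtain rfl : m = 0 := by simpa using Fintype.card_le_of_embedding e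
    congr 2
    funext x
    congr 2
    exact Subsingleton.elim _ _
  | succ n ih =>
    by_cases hs : Function.Surjective e
    · obtain rfl : m = n + 1 := by
        simpa using Fintype.card_of_bijective ⟨e.injective, hs⟩
      congr 1
      have hfp : Measurable fun x : Fin (n + 1) → Λ =>
          f x * ENNReal.ofReal (projectionDet u I x) :=
        hf.mul (measurable_projectionDet hm I).ennreal_ofReal
      rw [← lintegral_pi_comp_equiv (Equiv.ofBijective e ⟨e.injective, hs⟩) hfp]
      simp only [projectionDet_reindex]
      rfl
    · simp only [Function.Surjective, not_forall, not_exists] at hs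
      obtain ⟨v, hv⟩ := hs
      choose e' he' using fun i => Fin.exists_succAbove_eq (hv i)
      have he'i : Function.Injective e' := by
        intro i j hij
        refine e.injective ?_
        rw [← he' i, ← he' j, hij]
      rw [← ih (by omega) ⟨e', he'i⟩]
      simp only [← he', Function.Embedding.coeFn_mk]
      rw [hu.lintegral_comp_succAbove hm I hn v (f := fun x => f fun i => x (e' i))
        (hf.comp (measurable_pi_lambda _ fun i => measurable_pi_apply _)), ← mul_assoc,
        ← Nat.cast_mul, mul_comm (Nat.factorial _)]
      congr 2
      obtain ⟨r, hr⟩ : ∃ r, I.card - n = r + 1 := ⟨I.card - n - 1, by omega⟩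
      have hr' : I.card - (n + 1) = r := by omega
      rw [hr, hr', Nat.factorial_succ]

theorem QuaternionOrthonormal.lintegral_projectionDet (hu : QuaternionOrthonormal μ u)
    (hm : ∀ k, StronglyMeasurable (u k)) (I : Finset ι) (m : ℕ) :
    ∫⁻ x : Fin m → Λ, ENNReal.ofReal (projectionDet u I x) ∂(Measure.pi fun _ => μ) =
      I.card.descFactorial m := by
  by_cases h : m ≤ I.card
  · have h1 := hu.lintegral_comp_embedding hm I h
      (Function.Embedding.ofIsEmpty : Fin 0 ↪ Fin m) (f := fun _ => 1) measurable_const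
    simp only [one_mul, lintegral_pi_fin_zero] at h1
    have h2 : projectionDet u I (Fin.elim0 : Fin 0 → Λ) = 1 := by
      rw [projectionDet_eq_gramDet, gramDet_of_isEmpty]
    rw [h2, ENNReal.ofReal_one, mul_one, Nat.sub_zero, ← Nat.factorial_mul_descFactorial h,
      Nat.cast_mul] at h1
    exact (ENNReal.mul_right_inj (by simp [Nat.factorial_ne_zero]) (by simp)).1 h1
  · rw [Nat.descFactorial_of_lt (by omega)]
    simp [projectionDet_eq_zero_of_card_lt u (I := I) (V := Fin m) (by simpa using h)]

end Marginals

/-! ### The random finite set of independent Bernoulli variables -/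

section Bernoulli

variable {ι : Type*}

open scoped Classical in
/-- There is a probability distribution on the finite subsets of `ι` for which the events `k ∈ I`
are independent, with the given summable probabilities. -/
theorem exists_weights_finset [Countable ι] {l : ι → ℝ} (hl : ∀ k, l k ∈ Set.Icc (0 : ℝ) 1)
    (hsum : Summable l) :
    ∃ w : Finset ι → ℝ≥0∞, ∀ J : Finset ι,
      ∑' I, (if J ⊆ I then w I else 0) = ∏ k ∈ J, ENNReal.ofReal (l k) := by
  let β : ι → Measure Bool := fun k =>
    ENNReal.ofReal (l k) • Measure.dirac true + ENNReal.ofReal (1 - l k) • Measure.dirac false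
  have hβ : ∀ k, IsProbabilityMeasure (β k) := by
    intro k
    refine ⟨?_⟩
    simp only [β, Measure.add_apply, Measure.smul_apply, measure_univ, smul_eq_mul, mul_one]
    rw [← ENNReal.ofReal_add (hl k).1 (by linarith [(hl k).2])]
    simp
  have hβt : ∀ k, β k {true} = ENNReal.ofReal (l k) := by
    intro k
    simp [β]
  let ν : Measure (ι → Bool) := Measure.infinitePi β
  have hE : ∀ k, MeasurableSet {ω : ι → Bool | ω k = true} := fun k =>
    (measurable_pi_apply k : Measurable fun ω : ι → Bool => ω k) (measurableSet_singleton true)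
  have hJ : ∀ J : Finset ι, ν {ω | ∀ k ∈ J, ω k = true} = ∏ k ∈ J, ENNReal.ofReal (l k) := by
    intro J
    have := Measure.infinitePi_pi β (s := J) (t := fun _ => {true})
      (fun _ _ => measurableSet_singleton _)
    simp only [hβt] at this
    rw [← this]
    rfl
  -- Borel–Cantelli; here the summability of the probabilities enters.
  have hfin : ∀ᵐ ω ∂ν, {k | ω k = true}.Finite := by
    refine ae_finite_setOfPred_mem (s := fun k => {ω : ι → Bool | ω k = true}) ?_
    have h1 : ∀ k, ν {ω : ι → Bool | ω k = true} = ENNReal.ofReal (l k) := by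
      intro k
      have := hJ {k}
      simpa using this
    simp only [h1]
    exact hsum.tsum_ofReal_ne_top
  let S : Finset ι → Set (ι → Bool) := fun I => {ω | ∀ k, ω k = true ↔ k ∈ I}
  have hS : ∀ I, MeasurableSet (S I) := by
    intro I
    have : S I = ⋂ k, {ω | ω k = true ↔ k ∈ I} := by
      ext ω
      simp [S]
    rw [this]
    refine MeasurableSet.iInter fun k => ?_
    by_cases hk : k ∈ I
    · simpa [hk] using hE k
    · have hc : {ω : ι → Bool | ω k = true ↔ k ∈ I} = {ω | ω k = true}ᶜ := by
        ext ω
        simp [hk]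
      rw [hc]
      exact (hE k).compl
  refine ⟨fun I => ν (S I), fun J => ?_⟩
  rw [← hJ J]
  -- `S I` is the event that the random set equals `I`; almost surely, the random set contains `J`
  -- exactly when one of the disjoint events `S I` with `J ⊆ I` occurs.
  have hdisj : Pairwise (Function.onFun Disjoint fun I => if J ⊆ I then S I else ∅) := by
    intro I I' hne
    rw [Function.onFun, Set.disjoint_left]
    intro ω h1 h2
    split_ifs at h1 h2
    · refine hne (Finset.ext fun k => ?_)
      rw [← h1 k, ← h2 k]
    all_goals simp_all
  have hmeas : ∀ I, MeasurableSet (if J ⊆ I then S I else ∅) := by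
    intro I
    split_ifs
    exacts [hS I, MeasurableSet.empty]
  have h1 : ∀ I, (if J ⊆ I then ν (S I) else 0) = ν (if J ⊆ I then S I else ∅) := by
    intro I
    split_ifs <;> simp
  simp only [h1]
  rw [← measure_iUnion hdisj hmeas]
  refine measure_congr ?_
  filter_upwards [hfin] with ω hω
  refine propext ⟨fun h k hk => ?_, fun h => ?_⟩
  · obtain ⟨I, hI⟩ := Set.mem_iUnion.1 h
    split_ifs at hI with hJI
    · exact (hI k).2 (hJI hk)
    · exact hI.elim
  · refine Set.mem_iUnion.2 ⟨hω.toFinset, ?_⟩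
    rw [if_pos]
    · intro k
      simp
    · intro k hk
      simpa using h k hk

theorem tsum_prod_fin_eq_pow (m : ℕ) (a : ι → ℝ≥0∞) :
    ∑' k : Fin m → ι, ∏ i, a (k i) = (∑' j, a j) ^ m := by
  induction m with
  | zero => simp
  | succ m ih =>
    rw [← (Fin.consEquiv fun _ : Fin (m + 1) => ι).tsum_eq, ENNReal.tsum_prod', pow_succ', ← ih,
      ← ENNReal.tsum_mul_right]
    refine tsum_congr fun j => ?_
    rw [← ENNReal.tsum_mul_left]
    refine tsum_congr fun k => ?_
    simp [Fin.prod_univ_succ, Fin.consEquiv]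

end Bernoulli

/-! ### Random configurations with determinantal densities -/

section Configurations

variable {Λ : Type*} [TopologicalSpace Λ]

namespace Configuration

/-- The configuration of the points of a tuple. -/
def ofTuple {n : ℕ} (x : Fin n → Λ) : Configuration Λ where
  carrier := Set.range x
  countable := (Set.finite_range x).countable
  locallyFinite := fun _ _ => (Set.finite_range x).inter_of_left _

open scoped Classical in
theorem count_ofTuple {n : ℕ} {x : Fin n → Λ} (hx : Function.Injective x) (A : Set Λ) :
    (ofTuple x).count A = ((Finset.univ.filter fun i => x i ∈ A).card : ℕ∞) := by
  have h : Set.range x ∩ A = x '' (Finset.univ.filter fun i => x i ∈ A : Finset (Fin n)) := by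
    ext y
    constructor
    · rintro ⟨⟨i, rfl⟩, hi⟩
      exact ⟨i, by simpa using hi, rfl⟩
    · rintro ⟨i, hi, rfl⟩
      exact ⟨⟨i, rfl⟩, by simpa using hi⟩
  change (Set.range x ∩ A).encard = _
  rw [h, hx.encard_image, Set.encard_coe_eq_coe_finsetCard]

theorem fallingCount_of_count_eq {S : Configuration Λ} {A : Set Λ} {N : ℕ}
    (h : S.count A = N) (k : ℕ) : S.fallingCount A k = N.descFactorial k := by
  rw [fallingCount, h, Nat.descFactorial_eq_prod_range, Nat.cast_prod]
  refine Finset.prod_congr rfl fun j _ => ?_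
  rw [ENat.toENNReal_coe, ENNReal.natCast_sub]

variable [MeasurableSpace Λ]

theorem measurableSet_count_eq {A : Set Λ} (hA : MeasurableSet A) (n : ℕ∞) :
    MeasurableSet {S : Configuration Λ | S.count A = n} :=
  MeasurableSpace.measurableSet_generateFrom ⟨A, hA, n, rfl⟩

/-- Since `ℕ∞` is countable, every preimage is a countable union of generating events, whatever `g`
is. -/
theorem measurable_comp_count {β : Type*} [MeasurableSpace β] {A : Set Λ} (hA : MeasurableSet A)
    (g : ℕ∞ → β) : Measurable fun S : Configuration Λ => g (S.count A) := by
  intro T _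
  have : (fun S : Configuration Λ => g (S.count A)) ⁻¹' T =
      ⋃ n ∈ g ⁻¹' T, {S | S.count A = n} := by
    ext S
    simp
  rw [this]
  exact MeasurableSet.biUnion (Set.to_countable _) fun n _ => measurableSet_count_eq hA n

theorem measurable_fallingCount {A : Set Λ} (hA : MeasurableSet A) (k : ℕ) :
    Measurable fun S : Configuration Λ => S.fallingCount A k :=
  measurable_comp_count hA fun c => ∏ j ∈ Finset.range k, ((c : ℝ≥0∞) - (j : ℝ≥0∞))

end Configuration

/-- Families of injections into disjoint parts, as injections of the disjoint union. -/
noncomputable def piEmbeddingEquiv {m n r : ℕ} (x : Fin n → Λ) (A : Fin r → Set Λ) (κ : Fin r → ℕ)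
    (hκ : ∑ i, κ i = m) (hdisj : Pairwise fun i j => Disjoint (A i) (A j)) :
    (∀ i, Fin (κ i) ↪ {j // x j ∈ A i}) ≃
      {e : Fin m ↪ Fin n // ∀ i j, x (e ((finSigmaFinEquiv ⟨i, j⟩).cast hκ)) ∈ A i} where
  toFun g := ⟨⟨fun t => (g (finSigmaFinEquiv.symm (t.cast hκ.symm)).1
      (finSigmaFinEquiv.symm (t.cast hκ.symm)).2).1, by
    intro t t' h
    beta_reduce at h
    generalize hz : finSigmaFinEquiv.symm (t.cast hκ.symm) = z at h
    generalize hz' : finSigmaFinEquiv.symm (t'.cast hκ.symm) = z' at h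
    have hzz : z = z' := by
      obtain ⟨i, j⟩ := z
      obtain ⟨i', j'⟩ := z'
      have hi : i = i' := by
        by_contra hne
        refine Set.disjoint_left.1 (hdisj hne) (g i j).2 ?_
        rw [h]
        exact (g i' j').2
      subst hi
      congr 1
      exact (g i).injective (Subtype.ext h)
    rw [hzz, ← hz'] at hz
    simpa using hz⟩, by
    intro i j
    change x (g (finSigmaFinEquiv.symm (finSigmaFinEquiv ⟨i, j⟩)).1
      (finSigmaFinEquiv.symm (finSigmaFinEquiv ⟨i, j⟩)).2).1 ∈ A i
    generalize hz : finSigmaFinEquiv.symm (finSigmaFinEquiv ⟨i, j⟩) = z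
    rw [Equiv.symm_apply_apply] at hz
    subst hz
    exact (g i j).2⟩
  invFun e := fun i => ⟨fun j => ⟨e.1 ((finSigmaFinEquiv ⟨i, j⟩).cast hκ), e.2 i j⟩, by
    intro j j' h
    have := e.1.injective (congrArg Subtype.val h)
    simpa using this⟩
  left_inv g := by
    funext i
    refine DFunLike.ext _ _ fun j => Subtype.ext ?_
    change (g (finSigmaFinEquiv.symm (finSigmaFinEquiv ⟨i, j⟩)).1
      (finSigmaFinEquiv.symm (finSigmaFinEquiv ⟨i, j⟩)).2).1 = (g i j).1
    generalize hz : finSigmaFinEquiv.symm (finSigmaFinEquiv ⟨i, j⟩) = z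
    rw [Equiv.symm_apply_apply] at hz
    subst hz
    rfl
  right_inv e := by
    refine Subtype.ext (DFunLike.ext _ _ fun t => ?_)
    change e.1 (Fin.cast hκ (finSigmaFinEquiv (finSigmaFinEquiv.symm (Fin.cast hκ.symm t)))) = _
    rw [Equiv.apply_symm_apply]
    rfl

open scoped Classical in
-- The falling factorial counts injections of `κ i` labels into the points lying in `A i`;
-- disjointness of the `A i` glues these into one injection of all labels.
theorem prod_fallingCount_ofTuple {m n r : ℕ} {x : Fin n → Λ} (hx : Function.Injective x)
    (A : Fin r → Set Λ) (κ : Fin r → ℕ) (hκ : ∑ i, κ i = m)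
    (hdisj : Pairwise fun i j => Disjoint (A i) (A j)) :
    ∏ i, (Configuration.ofTuple x).fallingCount (A i) (κ i) =
      ∑ e : Fin m ↪ Fin n, Set.indicator {y : Fin m → Λ | ∀ (i : Fin r) (j : Fin (κ i)),
        y ((finSigmaFinEquiv ⟨i, j⟩).cast hκ) ∈ A i} (fun _ => (1 : ℝ≥0∞)) fun i => x (e i) := by
  have h1 : ∀ i, (Configuration.ofTuple x).fallingCount (A i) (κ i) =
      (Fintype.card (Fin (κ i) ↪ {j // x j ∈ A i}) : ℝ≥0∞) := by
    intro i
    rw [Configuration.fallingCount_of_count_eq (Configuration.count_ofTuple hx (A i)),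
      Fintype.card_embedding_eq, Fintype.card_fin, Fintype.card_subtype]
  rw [Finset.prod_congr rfl fun i _ => h1 i, ← Nat.cast_prod, ← Fintype.card_pi,
    Fintype.card_congr (piEmbeddingEquiv x A κ hκ hdisj), Fintype.card_subtype,
    Finset.card_filter, Nat.cast_sum]
  refine Finset.sum_congr rfl fun e _ => ?_
  simp [Set.indicator_apply]

variable [MeasurableSpace Λ] {μ : Measure Λ} {ι : Type*} {u : ι → Λ → ℍ[ℝ]}

open scoped Classical in
/-- The configuration of a tuple, outside of the zero set of the density. -/
noncomputable def projectionConfiguration (u : ι → Λ → ℍ[ℝ]) (I : Finset ι)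
    (x : Fin I.card → Λ) : Configuration Λ :=
  if projectionDet u I x = 0 then Configuration.ofTuple Fin.elim0 else Configuration.ofTuple x

/-- Off the zero set of the density the tuple is injective, so the count is a finite sum of
indicators; the diagonal of `Λ` need not be measurable. -/
theorem measurable_projectionConfiguration (hm : ∀ k, StronglyMeasurable (u k)) (I : Finset ι) :
    Measurable (projectionConfiguration u I) := by
  classical
  refine measurable_generateFrom ?_
  rintro _ ⟨A, hA, n, rfl⟩
  have hpd : MeasurableSet {x : Fin I.card → Λ | projectionDet u I x = 0} :=
    measurable_projectionDet hm I (measurableSet_singleton 0)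
  let N : (Fin I.card → Λ) → ℕ := fun x => if projectionDet u I x = 0 then 0 else
    ∑ i, if x i ∈ A then 1 else 0
  have hN : Measurable N := by
    refine Measurable.ite hpd measurable_const (Finset.measurable_sum _ fun i _ => ?_)
    exact Measurable.ite (measurable_pi_apply i hA) measurable_const measurable_const
  have hc : ∀ x, (projectionConfiguration u I x).count A = N x := by
    intro x
    by_cases hx : projectionDet u I x = 0
    · simp only [projectionConfiguration, N, if_pos hx]
      rw [Configuration.count_ofTuple (Function.injective_of_subsingleton _)]
      simp
    · simp only [projectionConfiguration, N, if_neg hx]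
      rw [Configuration.count_ofTuple (injective_of_projectionDet_ne_zero hx), Finset.card_filter]
  have : projectionConfiguration u I ⁻¹' {S | S.count A = n} = N ⁻¹' {k | (k : ℕ∞) = n} := by
    ext x
    simp [hc]
  rw [this]
  exact hN (MeasurableSet.of_discrete)

/-- The law of the random configuration that, with weight `w I`, has the determinant of the
projection kernel of `I` as its density. -/
noncomputable def mixtureLaw (μ : Measure Λ) (u : ι → Λ → ℍ[ℝ]) (w : Finset ι → ℝ≥0∞) :
    Measure (Configuration Λ) :=
  Measure.sum fun I => w I • Measure.map (projectionConfiguration u I)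
    ((Measure.pi fun _ => μ).withDensity fun x =>
      ((I.card.factorial : ℝ≥0∞)⁻¹ * ENNReal.ofReal (projectionDet u I x)))

theorem lintegral_mixtureLaw (hm : ∀ k, StronglyMeasurable (u k)) (w : Finset ι → ℝ≥0∞)
    {F : Configuration Λ → ℝ≥0∞} (hF : Measurable F) :
    ∫⁻ S, F S ∂(mixtureLaw μ u w) = ∑' I, w I * ((I.card.factorial : ℝ≥0∞)⁻¹ *
      ∫⁻ x, F (projectionConfiguration u I x) * ENNReal.ofReal (projectionDet u I x)
        ∂(Measure.pi fun _ => μ)) := by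
  rw [mixtureLaw, lintegral_sum_measure]
  refine tsum_congr fun I => ?_
  have hc := measurable_projectionConfiguration hm I
  have hpd : Measurable fun x : Fin I.card → Λ => ENNReal.ofReal (projectionDet u I x) :=
    (measurable_projectionDet hm I).ennreal_ofReal
  have hFc : Measurable fun x => F (projectionConfiguration u I x) := hF.comp hc
  have hprod : Measurable fun x => F (projectionConfiguration u I x) *
      ENNReal.ofReal (projectionDet u I x) := hFc.mul hpd
  rw [lintegral_smul_measure, lintegral_map hF hc,
    lintegral_withDensity_eq_lintegral_mul _ (hpd.const_mul _) hFc, smul_eq_mul,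
    ← lintegral_const_mul _ hprod]
  congr 1
  refine lintegral_congr fun x => ?_
  rw [Pi.mul_apply]
  ring

variable [SigmaFinite μ]

theorem QuaternionOrthonormal.isProbabilityMeasure_mixtureLaw (hu : QuaternionOrthonormal μ u)
    (hm : ∀ k, StronglyMeasurable (u k)) {w : Finset ι → ℝ≥0∞} (hw : ∑' I, w I = 1) :
    IsProbabilityMeasure (mixtureLaw μ u w) := by
  refine ⟨?_⟩
  have h := lintegral_mixtureLaw (μ := μ) hm w (F := fun _ => 1) measurable_const
  rw [lintegral_one] at h
  refine (h.trans (tsum_congr fun I => ?_)).trans hw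
  simp only [one_mul]
  rw [hu.lintegral_projectionDet hm, Nat.descFactorial_self,
    ENNReal.inv_mul_cancel (by simp [Nat.factorial_ne_zero]) (by simp), mul_one]

/-- The factorial moments of the random configuration. -/
theorem QuaternionOrthonormal.lintegral_prod_fallingCount [Countable ι]
    (hu : QuaternionOrthonormal μ u)
    (hm : ∀ k, StronglyMeasurable (u k)) (w : Finset ι → ℝ≥0∞) {m r : ℕ}
    (A : Fin r → Set Λ) (κ : Fin r → ℕ) (hκ : ∑ i, κ i = m) (hA : ∀ i, MeasurableSet (A i))
    (hdisj : Pairwise fun i j => Disjoint (A i) (A j)) :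
    ∫⁻ S, ∏ i, S.fallingCount (A i) (κ i) ∂(mixtureLaw μ u w) =
      ∫⁻ y in {y : Fin m → Λ | ∀ (i : Fin r) (j : Fin (κ i)),
        y ((finSigmaFinEquiv ⟨i, j⟩).cast hκ) ∈ A i},
        ∑' I, w I * ENNReal.ofReal (projectionDet u I y) ∂(Measure.pi fun _ => μ) := by
  set B := {y : Fin m → Λ | ∀ (i : Fin r) (j : Fin (κ i)),
    y ((finSigmaFinEquiv ⟨i, j⟩).cast hκ) ∈ A i} with hB
  have hBm : MeasurableSet B := by
    have : B = ⋂ i, ⋂ j : Fin (κ i),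
        (fun y : Fin m → Λ => y ((finSigmaFinEquiv ⟨i, j⟩).cast hκ)) ⁻¹' A i := by
      ext y
      simp [hB]
    rw [this]
    exact MeasurableSet.iInter fun i => MeasurableSet.iInter fun j => measurable_pi_apply _ (hA i)
  have hpd : ∀ (I : Finset ι) {k : ℕ},
      Measurable fun x : Fin k → Λ => ENNReal.ofReal (projectionDet u I x) :=
    fun I {k} => (measurable_projectionDet hm I).ennreal_ofReal
  rw [lintegral_mixtureLaw hm w (Finset.measurable_prod _ fun i _ =>
    Configuration.measurable_fallingCount (hA i) _),
    lintegral_tsum fun I => ((hpd I).const_mul _).aemeasurable]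
  refine tsum_congr fun I => ?_
  rw [lintegral_const_mul _ (hpd I)]
  congr 1
  have hind : Measurable (B.indicator fun _ => (1 : ℝ≥0∞)) := measurable_const.indicator hBm
  have h1 : ∀ x : Fin I.card → Λ, (∏ i, (projectionConfiguration u I x).fallingCount (A i) (κ i)) *
      ENNReal.ofReal (projectionDet u I x) = ∑ e : Fin m ↪ Fin I.card,
        B.indicator (fun _ => 1) (fun i => x (e i)) * ENNReal.ofReal (projectionDet u I x) := by
    intro x
    by_cases hx : projectionDet u I x = 0
    · simp [hx]
    · rw [projectionConfiguration, if_neg hx, prod_fallingCount_ofTuple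
        (injective_of_projectionDet_ne_zero hx) A κ hκ hdisj, Finset.sum_mul]
  simp only [h1]
  rw [lintegral_finsetSum]
  swap
  · intro e _
    exact (hind.comp (measurable_pi_lambda _ fun i => measurable_pi_apply _)).mul (hpd I)
  -- There are `N! / (N - m)!` embeddings, each contributing `(N - m)!` times the same integral;
  -- this cancels the `1 / N!`. If `m > N`, both sides vanish.
  by_cases hmI : m ≤ I.card
  · have h2 : ∀ e : Fin m ↪ Fin I.card, ∫⁻ x, B.indicator (fun _ => 1) (fun i => x (e i)) *
        ENNReal.ofReal (projectionDet u I x) ∂(Measure.pi fun _ => μ) =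
        (I.card - m).factorial *
          ∫⁻ y in B, ENNReal.ofReal (projectionDet u I y) ∂(Measure.pi fun _ => μ) := by
      intro e
      have := hu.lintegral_comp_embedding hm I le_rfl e hind
      rw [Nat.sub_self, Nat.factorial_zero, Nat.cast_one, one_mul] at this
      rw [this, ← lintegral_indicator hBm]
      congr 2
      funext y
      by_cases hy : y ∈ B <;> simp [hy]
    rw [Finset.sum_congr rfl fun e _ => h2 e, Finset.sum_const, Finset.card_univ,
      Fintype.card_embedding_eq, Fintype.card_fin, Fintype.card_fin, nsmul_eq_mul, ← mul_assoc,
      ← mul_assoc, mul_assoc _ (Nat.cast _) (Nat.cast _), ← Nat.cast_mul,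
      mul_comm (Nat.descFactorial _ _), Nat.factorial_mul_descFactorial hmI,
      ENNReal.inv_mul_cancel (by simp [Nat.factorial_ne_zero]) (by simp), one_mul]
  · have : IsEmpty (Fin m ↪ Fin I.card) := by
      rw [← Fintype.card_eq_zero_iff, Fintype.card_embedding_eq, Fintype.card_fin,
        Fintype.card_fin, Nat.descFactorial_of_lt (by omega)]
    simp [projectionDet_eq_zero_of_card_lt u (I := I) (V := Fin m) (by simpa using hmI)]

end Configurations

/-! ### The Pfaffian point field of a kernel with a real diagonal form -/

section Mixture

variable {ι Λ : Type*}

theorem realQuaternionToComplexified_re (q : ℍ[ℝ]) :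
    (realQuaternionToComplexified q).re = (q.re : ℂ) := rfl

theorem realQuaternionToComplexified_imI (q : ℍ[ℝ]) :
    (realQuaternionToComplexified q).imI = (q.imI : ℂ) := rfl

theorem realQuaternionToComplexified_imJ (q : ℍ[ℝ]) :
    (realQuaternionToComplexified q).imJ = (q.imJ : ℂ) := rfl

theorem realQuaternionToComplexified_imK (q : ℍ[ℝ]) :
    (realQuaternionToComplexified q).imK = (q.imK : ℂ) := rfl

/-- The inclusion of the real quaternions into the complexified ones, as a ring homomorphism. -/
noncomputable def realQuaternionHom : ℍ[ℝ] →+* ℍ[ℂ] where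
  toFun := realQuaternionToComplexified
  map_one' := by ext <;> simp [realQuaternionToComplexified]
  map_mul' x y := by
    refine Quaternion.ext _ _ ?_ ?_ ?_ ?_ <;>
      simp only [Quaternion.re_mul, Quaternion.imI_mul, Quaternion.imJ_mul, Quaternion.imK_mul,
        realQuaternionToComplexified_re, realQuaternionToComplexified_imI,
        realQuaternionToComplexified_imJ, realQuaternionToComplexified_imK,
        Complex.ofReal_mul, Complex.ofReal_add, Complex.ofReal_sub]
  map_zero' := by ext <;> simp [realQuaternionToComplexified]
  map_add' x y := by
    refine Quaternion.ext _ _ ?_ ?_ ?_ ?_ <;>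
      simp only [Quaternion.re_add, Quaternion.imI_add, Quaternion.imJ_add, Quaternion.imK_add,
        realQuaternionToComplexified_re, realQuaternionToComplexified_imI,
        realQuaternionToComplexified_imJ, realQuaternionToComplexified_imK,
        Complex.ofReal_add]

theorem map_mooreDysonDet {A B : Type*} [Ring A] [Ring B] (f : A →+* B) {n : ℕ}
    (X : Matrix (Fin n) (Fin n) A) :
    f (mooreDysonDet X) = mooreDysonDet (Matrix.of fun i j => f (X i j)) := by
  have h : ∀ σ i, f (cycleProduct X σ i) =
      cycleProduct (Matrix.of fun i j => f (X i j)) σ i := by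
    intro σ i
    simp only [cycleProduct, map_list_prod, List.map_map]
    rfl
  simp only [mooreDysonDet, map_sum, map_zsmul, map_list_prod, List.map_map, Function.comp_def, h]

theorem mooreReal_tsum_nonneg {V : Type*} [Fintype V] [DecidableEq V] {l : ι → ℝ}
    (hl : ∀ k, 0 ≤ l k) {u : ι → Λ → ℍ[ℝ]} {x : V → Λ}
    (hs : ∀ i j, Summable fun k => ‖l k • (u k (x i) * star (u k (x j)))‖) :
    0 ≤ mooreReal fun i j => ∑' k, l k • (u k (x i) * star (u k (x j))) := by
  have hlim : Filter.Tendsto (fun F : Finset ι =>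
      mooreReal (fun i j => ∑ k ∈ F, l k • (u k (x i) * star (u k (x j))))) Filter.atTop
      (nhds (mooreReal fun i j => ∑' k, l k • (u k (x i) * star (u k (x j))))) := by
    refine (continuous_mooreReal.tendsto _).comp ?_
    exact tendsto_pi_nhds.2 fun i => tendsto_pi_nhds.2 fun j => (hs i j).of_norm.hasSum
  refine ge_of_tendsto' hlim fun F => ?_
  have h := factorial_mul_mooreReal l u F x
  refine nonneg_of_mul_nonneg_right (a := ((Fintype.card V).factorial : ℝ)) ?_ (by positivity)
  rw [h]
  exact Finset.sum_nonneg fun k _ =>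
    mul_nonneg (Finset.prod_nonneg fun i _ => hl _) (gramDet_nonneg _)

open scoped Classical in
-- After multiplication by `m!`, with `m = card V`, both sides are sums over index tuples `k`. The
-- weights give the image of `k` the probability `∏ l` over that image, which is `∏ l (k i)` for
-- injective `k`; for other `k` the Gram determinant is zero.
theorem tsum_weights_projectionDet {V : Type*} [Fintype V] [DecidableEq V] {l : ι → ℝ}
    (hl : ∀ k, 0 ≤ l k) {w : Finset ι → ℝ≥0∞}
    (hw : ∀ J : Finset ι, ∑' I, (if J ⊆ I then w I else 0) = ∏ k ∈ J, ENNReal.ofReal (l k))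
    {u : ι → Λ → ℍ[ℝ]} {x : V → Λ}
    (hs : ∀ i j, Summable fun k => ‖l k • (u k (x i) * star (u k (x j)))‖) :
    ∑' I, w I * ENNReal.ofReal (projectionDet u I x) = ENNReal.ofReal
      (mooreReal fun i j => ∑' k, l k • (u k (x i) * star (u k (x j)))) := by
  have hf0 : ((Fintype.card V).factorial : ℝ≥0∞) ≠ 0 := by simp [Nat.factorial_ne_zero]
  refine (ENNReal.mul_right_inj hf0 (by simp)).1 ?_
  rw [← tsum_ofReal_gramDet hl hs, ← ENNReal.tsum_mul_left]
  have h1 : ∀ I : Finset ι, ((Fintype.card V).factorial : ℝ≥0∞) *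
      (w I * ENNReal.ofReal (projectionDet u I x)) =
      ∑' k : V → ι, (if Finset.univ.image k ⊆ I then w I else 0) *
        ENNReal.ofReal (gramDet fun i v => u (k i) (x v)) := by
    intro I
    rw [mul_left_comm, ← ENNReal.ofReal_natCast, ← ENNReal.ofReal_mul (by positivity),
      factorial_mul_projectionDet, ENNReal.ofReal_sum_of_nonneg fun k _ => gramDet_nonneg _,
      Finset.mul_sum, tsum_eq_sum (s := Fintype.piFinset fun _ : V => I)]
    · refine Finset.sum_congr rfl fun k hk => ?_
      rw [if_pos]
      rw [Finset.image_subset_iff]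
      exact fun i _ => Fintype.mem_piFinset.1 hk i
    · intro k hk
      rw [if_neg, zero_mul]
      intro h
      rw [Finset.image_subset_iff] at h
      exact hk (Fintype.mem_piFinset.2 fun i => h i (Finset.mem_univ i))
  rw [tsum_congr h1, ENNReal.tsum_comm]
  refine tsum_congr fun k => ?_
  rw [ENNReal.tsum_mul_right, hw]
  by_cases hk : Function.Injective k
  · rw [Finset.prod_image hk.injOn, ENNReal.ofReal_mul (Finset.prod_nonneg fun i _ => hl _),
      ENNReal.ofReal_prod_of_nonneg fun i _ => hl _]
  · have h0 : (gramDet fun i v => u (k i) (x v)) = 0 := by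
      simp only [Function.Injective, not_forall] at hk
      obtain ⟨a, b, hab, hne⟩ := hk
      exact gramDet_of_eq hne (by simp only [hab])
    simp [h0]

open scoped Classical in
-- The factorial moment counts injective `m`-tuples in `I`, so it is at most `(∑ l k) ^ m`.
theorem tsum_weights_descFactorial_lt_top {l : ι → ℝ} (hsum : Summable l)
    {w : Finset ι → ℝ≥0∞}
    (hw : ∀ J : Finset ι, ∑' I, (if J ⊆ I then w I else 0) = ∏ k ∈ J, ENNReal.ofReal (l k))
    (m : ℕ) : ∑' I : Finset ι, w I * I.card.descFactorial m < ∞ := by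
  have h1 : ∀ I : Finset ι, w I * (I.card.descFactorial m : ℝ≥0∞) ≤
      ∑' k : Fin m → ι, if Function.Injective k then
        (if Finset.univ.image k ⊆ I then w I else 0) else 0 := by
    intro I
    let φ : (Fin m ↪ I) → Fin m → ι := fun e i => (e i : ι)
    have hφ : Function.Injective φ := by
      intro e e' h
      ext i
      exact congrFun h i
    refine le_trans (le_of_eq ?_) (ENNReal.tsum_comp_le_tsum_of_injective hφ _)
    have h2 : ∀ e : Fin m ↪ I, (if Function.Injective (φ e) then
        (if Finset.univ.image (φ e) ⊆ I then w I else 0) else 0) = w I := by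
      intro e
      have hinj : Function.Injective (φ e) := Subtype.val_injective.comp e.injective
      rw [if_pos hinj, if_pos]
      rw [Finset.image_subset_iff]
      exact fun i _ => (e i).2
    rw [tsum_congr h2, tsum_fintype, Finset.sum_const, Finset.card_univ,
      Fintype.card_embedding_eq, Fintype.card_coe, Fintype.card_fin, nsmul_eq_mul, mul_comm]
  refine lt_of_le_of_lt (ENNReal.tsum_le_tsum h1) ?_
  rw [ENNReal.tsum_comm]
  refine lt_of_le_of_lt (ENNReal.tsum_le_tsum
    (g := fun k : Fin m → ι => ∏ i, ENNReal.ofReal (l (k i))) fun k => ?_) ?_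
  · by_cases hk : Function.Injective k
    · simp only [if_pos hk]
      rw [hw, Finset.prod_image hk.injOn]
    · simp [if_neg hk]
  · rw [tsum_prod_fin_eq_pow m fun j => ENNReal.ofReal (l j)]
    exact ENNReal.pow_lt_top hsum.tsum_ofReal_lt_top

/-- Projection to two distinct coordinates is in general only quasi-measure-preserving, since `μ`
need not have mass one; null sets still pull back to null sets. -/
theorem ae_pi_pair [MeasurableSpace Λ] {μ : Measure Λ} [SigmaFinite μ] {m : ℕ} {i j : Fin m}
    (hij : j ≠ i) {p : Λ × Λ → Prop} (hp : ∀ᵐ z ∂(μ.prod μ), p z) :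
    ∀ᵐ x ∂(Measure.pi fun _ : Fin m => μ), p (x i, x j) := by
  cases m with
  | zero => exact i.elim0
  | succ n =>
    obtain ⟨j', rfl⟩ := Fin.exists_succAbove_eq hij
    have h1 := (measurePreserving_piFinSuccAbove (fun _ : Fin (n + 1) => μ) i).quasiMeasurePreserving
    have h2 : Measure.QuasiMeasurePreserving
        (Prod.map id (Function.eval j')) (μ.prod (Measure.pi fun _ : Fin n => μ)) (μ.prod μ) :=
      QuasiMeasurePreserving.prodMap (.id μ)
        (Measure.quasiMeasurePreserving_eval (fun _ : Fin n => μ) j')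
    exact (h2.comp h1).ae hp

end Mixture

/-- No compatibility between the topology and the `σ`-algebra of `Λ` is needed; the topology only
enters through the local finiteness of configurations and the local integrability of correlation
functions.  The index set `ι` of the diagonal form may be finite or countably infinite. -/
theorem theorem1 {Λ : Type*} [TopologicalSpace Λ] [MeasurableSpace Λ] (μ : Measure Λ)
    [SigmaFinite μ] {ι : Type*} [Countable ι] (K : Λ → Λ → ℍ[ℂ]) (hK : IsSelfDualKernel K)
    (l : ι → ℝ) (u : ι → Λ → ℍ[ℝ]) (hKu : HasRealDiagonalForm μ K l u)
    (hl : ∀ k, l k ∈ Set.Icc (0 : ℝ) 1) (hsum : Summable l) :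
    ∃ P : Measure (Configuration Λ), IsPfaffianPointField μ P K ∧
      ∫⁻ S, (((S.count Set.univ : ℕ∞) : ℝ≥0∞)) ∂P < ∞ := by
  classical
  have hl0 : ∀ k, 0 ≤ l k := fun k => (hl k).1
  -- Strongly measurable representatives of the `u k`, so that the densities are genuinely
  -- measurable.
  let v : ι → Λ → ℍ[ℝ] := fun k => (hKu.memLp k).1.mk (u k)
  have hm : ∀ k, StronglyMeasurable (v k) := fun k => (hKu.memLp k).1.stronglyMeasurable_mk
  have huv : ∀ k, u k =ᵐ[μ] v k := fun k => (hKu.memLp k).1.ae_eq_mk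
  have hint : ∀ k k', ∫ x, star (v k x) * v k' x ∂μ = ∫ x, star (u k x) * u k' x ∂μ := by
    intro k k'
    refine integral_congr_ae ?_
    filter_upwards [huv k, huv k'] with x h1 h2
    rw [h1, h2]
  have hv : QuaternionOrthonormal μ v :=
    { memLp := fun k => (hKu.memLp k).ae_eq (huv k)
      integral_eq_one := fun k => (hint k k).trans ((hKu.orthonormal k k).1 rfl)
      integral_eq_zero := fun k k' h => (hint k k').trans ((hKu.orthonormal k k').2 h) }
  obtain ⟨w, hw⟩ := exists_weights_finset hl hsum
  have hw1 : ∑' I, w I = 1 := by simpa using hw ∅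
  let D : (m : ℕ) → (Fin m → Λ) → ℝ≥0∞ := fun m x =>
    ∑' I, w I * ENNReal.ofReal (projectionDet v I x)
  have hD : ∀ m, Measurable (D m) := fun m =>
    Measurable.tsum fun I => ((measurable_projectionDet hm I).ennreal_ofReal).const_mul _
  have hDfin : ∀ m, ∫⁻ x, D m x ∂(Measure.pi fun _ => μ) ≠ ∞ := by
    intro m
    rw [lintegral_tsum fun I =>
      (((measurable_projectionDet hm I).ennreal_ofReal).const_mul _).aemeasurable]
    refine ne_of_lt (lt_of_eq_of_lt (tsum_congr fun I => ?_)
      (tsum_weights_descFactorial_lt_top hsum hw m))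
    rw [lintegral_const_mul _ (measurable_projectionDet hm I).ennreal_ofReal,
      hv.lintegral_projectionDet hm]
  refine ⟨mixtureLaw μ v w, ⟨hv.isProbabilityMeasure_mixtureLaw hm hw1, hK, fun m _ => ?_⟩, ?_⟩
  -- `D m` may be infinite, but only on a null set because its integral is finite; `toReal` changes
  -- nothing elsewhere.
  · refine ⟨fun x => (D m x).toReal, ⟨fun x => ENNReal.toReal_nonneg,
      (hD m).ennreal_toReal.aemeasurable, ?_, ?_⟩, ?_⟩
    · exact (integrable_toReal_of_lintegral_ne_top (hD m).aemeasurable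
        (hDfin m)).locallyIntegrable
    · intro n A κ hκ hA hdisj
      rw [hv.lintegral_prod_fallingCount hm w A κ hκ hA hdisj]
      refine lintegral_congr_ae (ae_restrict_of_ae ?_)
      filter_upwards [ae_lt_top (hD m) (hDfin m)] with x hx
      exact (ENNReal.ofReal_toReal hx.ne).symm
    · have hdiag : ∀ᵐ x ∂(Measure.pi fun _ : Fin m => μ), ∀ i j,
          IsDiagonalSumAt K l u (x i) (x j) := by
        refine ae_all_iff.2 fun i => ae_all_iff.2 fun j => ?_
        -- Entries with `i = j` need the separate hypothesis on the diagonal, which may be a null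
        -- set of the product.
        by_cases hij : j = i
        · subst hij
          exact (Measure.quasiMeasurePreserving_eval (fun _ : Fin m => μ) j).ae hKu.ae_eq_diag
        · exact ae_pi_pair hij hKu.ae_eq
      have hvx : ∀ᵐ x ∂(Measure.pi fun _ : Fin m => μ), ∀ i k, u k (x i) = v k (x i) :=
        ae_all_iff.2 fun i => ae_all_iff.2 fun k =>
          (Measure.quasiMeasurePreserving_eval (fun _ : Fin m => μ) i).ae (huv k)
      filter_upwards [hdiag, hvx] with x hx hxv
      have hs : ∀ i j, Summable fun k => ‖l k • (v k (x i) * star (v k (x j)))‖ := by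
        intro i j
        simp only [← hxv]
        exact (hx i j).1
      set X : Matrix (Fin m) (Fin m) ℍ[ℝ] := Matrix.of fun i j =>
        ∑' k, l k • (v k (x i) * star (v k (x j))) with hX
      have hXK : (Matrix.of fun i j => K (x i) (x j)) =
          Matrix.of fun i j => realQuaternionHom (X i j) := by
        ext1 i j
        rw [Matrix.of_apply, Matrix.of_apply, (hx i j).2, hX, Matrix.of_apply]
        simp only [hxv]
        rfl
      have hXstar : ∀ i j, X j i = star (X i j) := by
        intro i j
        rw [hX, Matrix.of_apply, Matrix.of_apply, tsum_star]
        simp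
      rw [hXK, ← map_mooreDysonDet, mooreDysonDet_eq_symplecticDet hXstar]
      have hDx : D m x = ENNReal.ofReal (mooreReal X) := tsum_weights_projectionDet hl0 hw hs
      have hnn : 0 ≤ mooreReal X := mooreReal_tsum_nonneg hl0 hs
      rw [hDx, ENNReal.toReal_ofReal hnn]
      ext <;> simp [realQuaternionHom, realQuaternionToComplexified, mooreReal]
  -- The expected number of points is the first factorial moment of the whole space, bounded by the
  -- integral of `D 1`.
  · have h := hv.lintegral_prod_fallingCount hm w (m := 1) (fun _ : Fin 1 => Set.univ)
      (fun _ => 1) (by simp) (fun _ => MeasurableSet.univ) (fun i j hij =>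
        absurd (Subsingleton.elim i j) hij)
    have h1 : ∀ S : Configuration Λ, ((S.count Set.univ : ℕ∞) : ℝ≥0∞) =
        ∏ _i : Fin 1, S.fallingCount Set.univ 1 := by
      intro S
      simp [Configuration.fallingCount]
    simp only [h1]
    rw [h]
    exact lt_of_le_of_lt (setLIntegral_le_lintegral _ _) (hDfin 1).lt_top
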